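/- Let $N,m\ge 1$ be integers, let $\Omega\subset\mathbb{R}^N$ be a bounded domain (a nonempty open connected set) and let $0<q<1$. Let $a:\Omega\to[0,\infty)$ be measurable and bounded, and put $M_a(s)=\mathrm{meas}\{x\in\Omega: a(x)\le s\}$. Let $L$ be the divergence operator $$L(u)=(-1)^m\sum_{|\alpha|=m}D_x^\alpha a_\alpha(x,u,D_xu,\dots,D_x^mu),$$ where the $a_\alpha(x,\xi)$ are Carathéodory functions (measurable in $x\in\Omega$, continuous in $\xi=(\xi_\gamma)_{|\gamma|\le m}$) for which there are constants $c$ and $C>0$ such that, for all $x\in\Omega$ and all $\xi$, $$|a_\alpha(x,\xi)|\le c\sum_{|\gamma|=m}|\xi_\gamma|\quad(|\alpha|=m),\qquad \sum_{|\alpha|=m}a_\alpha(x,\xi)\,\xi_\alpha\ \ge\ C\sum_{|\gamma|=m}|\xi_\gamma|^2 .$$ Let $W_0^{m,2}(\Omega)$ be the closure, in the norm of $W^{m,2}(\Omega)$, of the space of $C^m$ functions with compact support in $\Omega$. For $u_0\in L^2(\Omega)$, a weak solution of the Cauchy–Dirichlet problem $$u_t+L(u)+a(x)|u|^{q-1}u=0\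 \text{ in }\Omega\times(0,\infty),\qquad D_x^\alpha u=0\ \text{ on }\partial\Omega\times(0,\infty)\ (|\alpha|\le m-1),\qquad u(\cdot,0)=u_0$$ is a function $u\in C([0,\infty),L^2(\Omega))\cap L^2_{loc}([0,\infty),W_0^{m,2}(\Omega))$ with $u(\cdot,0)=u_0$ whose distributional time derivative $u_t$ belongs to $L^2_{loc}([0,\infty),(W_0^{m,2}(\Omega))^*)$ and such that for all $\zeta\in L^2_{loc}([0,\infty),W_0^{m,2}(\Omega))$ and all $T>0$ $$\int_0^T\Big[\langle u_t,\zeta\rangle+\int_\Omega\Big(\sum_{|\alpha|=m}a_\alpha(x,u,\dots,D_x^mu)\,D_x^\alpha\zeta+a(x)|u|^{q-1}u\,\zeta\Big)dx\Big]dt=0 .$$ (a) If $N\ne 2m$ and $\int_0^1 s^{-1}M_a(s)^{\theta}\,ds<\infty$ with $\theta=\min(2m/N,1)$, then for every $u_0\in L^2(\Omega)$ and every weak solution $u$ there is $T_0>0$ such that $u(\cdot,t)=0$ a.e. in $\Omega$ for all $t\ge T_0$. (b) If $N=2m$, $\mathrm{meas}\{x\in\Omega: a(x)=0\}=0$, and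 $s\mapsto s^{-1}M_a(s)(-\ln M_a(s))$ (with $0\ln 0=0$) is integrable on $(0,1)$, then the same conclusion holds. -/

import Mathlib

open MeasureTheory Set
open scoped ContDiff

noncomputable section

namespace Extinction

/-- The Euclidean space `ℝ^N`. -/
abbrev Sp (N : ℕ) : Type := EuclideanSpace ℝ (Fin N)

/-- The multi-indices `γ = (γ₁, …, γ_N)` of length `|γ| = γ₁ + ⋯ + γ_N ≤ m`. -/
def multiIndices (N m : ℕ) : Finset (Fin N → ℕ) :=
  (Fintype.piFinset fun _ => Finset.range (m + 1)).filter fun γ => ∑ i, γ i ≤ m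

theorem mem_multiIndices {N m : ℕ} {γ : Fin N → ℕ} :
    γ ∈ multiIndices N m ↔ ∑ i, γ i ≤ m := by
  simp only [multiIndices, Finset.mem_filter, Fintype.mem_piFinset, Finset.mem_range,
    and_iff_right_iff_imp]
  intro h i
  exact Nat.lt_succ_of_le ((Finset.single_le_sum (fun j _ => Nat.zero_le (γ j))
    (Finset.mem_univ i)).trans h)

/-- The finite type of multi-indices of length at most `m`;
`MIdx N m → ℝ` is the space `ℝ^{M(m)}` of jets `ξ = (ξ_γ)_{|γ| ≤ m}`. -/
abbrev MIdx (N m : ℕ) : Type := ↥(multiIndices N m)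

/-- The zero multi-index. -/
def zeroIdx (N m : ℕ) : MIdx N m := ⟨0, mem_multiIndices.2 (by simp)⟩

/-- The multi-indices of length exactly `m`. -/
def topIdx (N m : ℕ) : Finset (MIdx N m) :=
  Finset.univ.filter fun γ => ∑ i, γ.1 i = m

/-- The list of directions `e₁, …, e₁, e₂, …, e₂, …, e_N, …, e_N`, with `e_i` taken `α_i` times. -/
def dirs {N : ℕ} (α : Fin N → ℕ) (j : Fin (∑ i, α i)) : Sp N :=
  EuclideanSpace.single (finSigmaFinEquiv.symm j).1 1

/-- The classical partial derivative `D^α φ = ∂₁^{α₁} ⋯ ∂_N^{α_N} φ`. -/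
def classicalD {N : ℕ} (α : Fin N → ℕ) (φ : Sp N → ℝ) (x : Sp N) : ℝ :=
  iteratedFDeriv ℝ (∑ i, α i) φ x (dirs α)

/-- The real Hilbert space `L²(Ω)` (Lebesgue measure on `Ω`). -/
abbrev L2 {N : ℕ} (Ω : Set (Sp N)) : Type := Lp ℝ 2 (volume.restrict Ω)

/-- Families `(v_γ)_{|γ| ≤ m}` in `L²(Ω)`, with the norm `(∑_γ ‖v_γ‖²)^{1/2}`. A function of
`W^{m,2}(Ω)` is represented by the family of its derivatives, and this norm is then
the norm of `W^{m,2}(Ω)`. -/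
abbrev Jets {N : ℕ} (Ω : Set (Sp N)) (m : ℕ) : Type :=
  PiLp 2 fun _ : MIdx N m => L2 Ω

/-- The space `C₀^m(Ω)` of `C^m` functions with compact support in `Ω`, each function `φ`
being represented by the family `(D^γ φ)_{|γ| ≤ m}` of its derivatives. -/
def testJets {N : ℕ} (Ω : Set (Sp N)) (m : ℕ) : Submodule ℝ (Jets Ω m) where
  carrier := {v | ∃ φ : Sp N → ℝ, ContDiff ℝ m φ ∧ HasCompactSupport φ ∧ tsupport φ ⊆ Ω ∧
    ∀ γ : MIdx N m, v γ =ᵐ[volume.restrict Ω] classicalD γ.1 φ}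
  zero_mem' := by
    refine ⟨fun _ => 0, contDiff_const, HasCompactSupport.zero, ?_, fun γ => ?_⟩
    · have : tsupport (fun _ : Sp N => (0 : ℝ)) = ∅ := tsupport_eq_empty_iff.2 rfl
      simp [this]
    · filter_upwards [Lp.coeFn_zero ℝ 2 (volume.restrict Ω)] with x hx
      have : iteratedFDeriv ℝ (∑ i, γ.1 i) (fun _ : Sp N => (0 : ℝ)) = 0 := iteratedFDeriv_zero
      simp only [classicalD, this]
      simpa using hx
  add_mem' := by
    rintro v w ⟨φ, hφ, hφc, hφs, hφv⟩ ⟨ψ, hψ, hψc, hψs, hψw⟩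
    refine ⟨φ + ψ, hφ.add hψ, hφc.add hψc,
      (tsupport_add φ ψ).trans (union_subset hφs hψs), fun γ => ?_⟩
    have hγ : ((∑ i, γ.1 i : ℕ) : WithTop ℕ∞) ≤ m := by
      exact_mod_cast mem_multiIndices.1 γ.2
    filter_upwards [Lp.coeFn_add (v γ) (w γ), hφv γ, hψw γ] with x h1 h2 h3
    have h4 : (v + w) γ = v γ + w γ := rfl
    rw [h4, h1, Pi.add_apply, h2, h3]
    simp only [classicalD]
    rw [iteratedFDeriv_add_apply (hφ.of_le hγ).contDiffAt (hψ.of_le hγ).contDiffAt]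
    rfl
  smul_mem' := by
    rintro c v ⟨φ, hφ, hφc, hφs, hφv⟩
    refine ⟨c • φ, hφ.const_smul c, hφc.smul_left (f := fun _ => c),
      (tsupport_smul_subset_right (fun _ => c) φ).trans hφs, fun γ => ?_⟩
    have hγ : ((∑ i, γ.1 i : ℕ) : WithTop ℕ∞) ≤ m := by
      exact_mod_cast mem_multiIndices.1 γ.2
    filter_upwards [Lp.coeFn_smul c (v γ), hφv γ] with x h1 h2
    have h4 : (c • v) γ = c • v γ := rfl
    rw [h4, h1, Pi.smul_apply, h2]
    simp only [classicalD]
    rw [iteratedFDeriv_const_smul_apply (hφ.of_le hγ).contDiffAt]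
    rfl

/-- The space `W₀^{m,2}(Ω)`: the closure of `C₀^m(Ω)` in the norm of `W^{m,2}(Ω)`. Its elements are
the families `(D^γ v)_{|γ| ≤ m}` of the weak derivatives of a function `v`
(a limit in `L²` of such families is again one), and `v` determines the family. -/
def sobolevZero {N : ℕ} (Ω : Set (Sp N)) (m : ℕ) : Submodule ℝ (Jets Ω m) :=
  (testJets Ω m).topologicalClosure

/-- `W₀^{m,2}(Ω)` as a normed space. -/
abbrev W0 {N : ℕ} (Ω : Set (Sp N)) (m : ℕ) : Type := ↥(sobolevZero Ω m)

/-- The weak derivative `D^γ v` in `L²(Ω)` of `v` in `W₀^{m,2}(Ω)`, for `|γ| ≤ m`. -/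
def weakD {N m : ℕ} {Ω : Set (Sp N)} (γ : MIdx N m) (v : W0 Ω m) : L2 Ω := v.1 γ

/-- The inclusion of `W₀^{m,2}(Ω)` in `L²(Ω)`. -/
def toL2 {N m : ℕ} {Ω : Set (Sp N)} (v : W0 Ω m) : L2 Ω := weakD (zeroIdx N m) v

/-- The space `L²_loc([0, ∞), X)` (strongly measurable, and square integrable
on `(0, T)` for all `T > 0`). -/
def L2Loc {X : Type*} [NormedAddCommGroup X] (f : ℝ → X) : Prop :=
  ∀ T : ℝ, 0 < T → MemLp f 2 (volume.restrict (Ioo 0 T))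

/-- `w` is the derivative `u_t` of `u`, in the sense of distributions on `(0, ∞)` with values in
the dual of `W₀^{m,2}(Ω)`, where `L²(Ω)` is embedded through its inner product. -/
def IsWeakTimeDeriv {N m : ℕ} {Ω : Set (Sp N)} (u : ℝ → L2 Ω) (w : ℝ → StrongDual ℝ (W0 Ω m)) :
    Prop :=
  ∀ v : W0 Ω m, ∀ η : ℝ → ℝ, ContDiff ℝ ∞ η → HasCompactSupport η → tsupport η ⊆ Ioi 0 →
    ∫ t in Ioi (0 : ℝ), inner ℝ (u t) (toL2 v) * deriv η t
      = -∫ t in Ioi (0 : ℝ), w t v * η t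

/-- The coefficients `a_α(x, ξ)`, `|α| = m`, of the operator
`L u = (-1)^m ∑_{|α| = m} D^α a_α(x, u, …, D^m u)` are Carathéodory functions on `Ω × ℝ^{M(m)}`
with `|a_α(x, ξ)| ≤ c ∑_{|γ| = m} |ξ_γ|`. -/
structure StructureCondition {N m : ℕ} (Ω : Set (Sp N))
    (A : MIdx N m → Sp N → (MIdx N m → ℝ) → ℝ) : Prop where
  measurable : ∀ α ∈ topIdx N m, ∀ ξ : MIdx N m → ℝ,
    AEMeasurable (fun x => A α x ξ) (volume.restrict Ω)
  continuous : ∀ α ∈ topIdx N m, ∀ x ∈ Ω, Continuous fun ξ => A α x ξ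
  growth : ∃ c : ℝ, ∀ α ∈ topIdx N m, ∀ x ∈ Ω, ∀ ξ : MIdx N m → ℝ,
    |A α x ξ| ≤ c * ∑ γ ∈ topIdx N m, |ξ γ|

/-- The strong coercivity
`∑_{|α| = m} a_α(x, ξ) ξ_α ≥ C ∑_{|γ| = m} |ξ_γ|²` with a constant `C > 0`. -/
def StronglyCoercive {N m : ℕ} (Ω : Set (Sp N))
    (A : MIdx N m → Sp N → (MIdx N m → ℝ) → ℝ) : Prop :=
  ∃ C : ℝ, 0 < C ∧ ∀ x ∈ Ω, ∀ ξ : MIdx N m → ℝ,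
    C * ∑ γ ∈ topIdx N m, |ξ γ| ^ 2 ≤ ∑ α ∈ topIdx N m, A α x ξ * ξ α

/-- `u ∈ C([0, ∞), L²(Ω)) ∩ L²_loc([0, ∞), W₀^{m,2}(Ω))` is a weak solution of
`u_t + L u + a(x) |u|^{q-1} u = 0` in `Ω × (0, ∞)` with zero Dirichlet data and `u(0) = u₀`.
Here `U` is `u` regarded as a function with values in `W₀^{m,2}(Ω)`, and `w` is `u_t`. -/
def IsWeakSolution {N m : ℕ} (Ω : Set (Sp N)) (A : MIdx N m → Sp N → (MIdx N m → ℝ) → ℝ)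
    (a : Sp N → ℝ) (q : ℝ) (u₀ : L2 Ω) (u : ℝ → L2 Ω) : Prop :=
  ContinuousOn u (Ici 0) ∧ u 0 = u₀ ∧
  ∃ (U : ℝ → W0 Ω m) (w : ℝ → StrongDual ℝ (W0 Ω m)),
    L2Loc U ∧ (∀ᵐ t ∂volume.restrict (Ioi (0 : ℝ)), toL2 (U t) = u t) ∧
    L2Loc w ∧ IsWeakTimeDeriv u w ∧
    ∀ ζ : ℝ → W0 Ω m, L2Loc ζ → ∀ T : ℝ, 0 < T →
      ∫ t in Ioo 0 T, (w t (ζ t) +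
        ∫ x in Ω, ((∑ α ∈ topIdx N m, A α x (fun γ => weakD γ (U t) x) * weakD α (ζ t) x)
          + a x * (|u t x| ^ (q - 1) * u t x) * toL2 (ζ t) x)) = 0

/-- Extinction in finite time: every weak solution, for every initial datum in `L²(Ω)`,
vanishes a.e. in `Ω` at all times after some `T₀ > 0`. -/
def ExtinctionInFiniteTime {N m : ℕ} (Ω : Set (Sp N))
    (A : MIdx N m → Sp N → (MIdx N m → ℝ) → ℝ) (a : Sp N → ℝ) (q : ℝ) : Prop :=
  ∀ (u₀ : L2 Ω) (u : ℝ → L2 Ω), IsWeakSolution Ω A a q u₀ u →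
    ∃ T₀ : ℝ, 0 < T₀ ∧ ∀ t : ℝ, T₀ ≤ t → u t =ᵐ[volume.restrict Ω] 0

/-- `M_a(s) = meas {x ∈ Ω : a(x) ≤ s}`. -/
def sublevelMeas {N : ℕ} (Ω : Set (Sp N)) (a : Sp N → ℝ) (s : ℝ) : ℝ :=
  volume.real {x ∈ Ω | a x ≤ s}

end Extinction

end

/-! Let E(t) be the integral over Ω of ∑ a_α D^α u + a|u|^{q+1}. Testing the equation with u gives
d/dt ‖u‖² = -2E (`IsWeakSolution.norm_sq_sub_eq`), and coercivity makes E control both D = ∑_{|γ|=m}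
‖D^γ u‖² and the absorption ∫ a|u|^{q+1}. While ‖u‖² lies between 4^{-k-1} and 4^{-k}, either E >
2^{-k}, or E is small and a bound ‖u‖² ≤ g_k E is available. Either way the level is crossed in time
O(2^{-k} + g_k), so summability of g_k gives extinction (`exists_eq_zero_of_dissipation`).

To find g_k when E ≤ ε = 2^{-k}, split Ω into {a ≤ s}, {a > s, |u| > τ} and {a > s, |u| ≤ τ}. On the
third set u² ≤ (τ^{1-q}/s) a|u|^{q+1}. The second has measure at most E/(τ^{q+1} s) by Chebyshev.
With s and τ suitable powers of ε, each of these two contributes E times a positive power of ε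
(`norm_sq_le_mul_energy`). The first set is treated by a localized inequality ∫_A u² ≤ K Φ(|A|) D,
where Φ(r) = r^θ if N ≠ 2m and Φ(r) = r(2 - log r), for r < 1, if N = 2m. Since s runs through a
geometric sequence, the sum of Φ(M_a(s)) is controlled by the integral in the hypothesis
(`summable_of_integrableOn_inv_mul`).

The localized inequality is proved on the Fourier side. If f̂ is cut at radius R, its low
frequencies are bounded in L¹, at the cost of a factor |A|, and its high frequencies in L² by
R^{-2m} D (`setIntegral_norm_sq_le`). Optimizing R in terms of |A| produces Φ. -/

noncomputable section

namespace Extinction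

open FourierTransform

/-! ### Plancherel's identity for the Fourier integral on L¹ ∩ L². -/

section Plancherel

variable {E : Type*} [NormedAddCommGroup E] [InnerProductSpace ℝ E] [FiniteDimensional ℝ E]
  [MeasurableSpace E] [BorelSpace E]

theorem continuous_fourier {f : E → ℂ} (hf : Integrable f) : Continuous (𝓕 f) :=
  VectorFourier.fourierIntegral_continuous Real.continuous_fourierChar
    (innerSL ℝ).continuous₂ hf

theorem norm_fourier_le (f : E → ℂ) (ξ : E) : ‖𝓕 f ξ‖ ≤ ∫ x, ‖f x‖ :=
  VectorFourier.norm_fourierIntegral_le_integral_norm _ _ _ _ _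

theorem integral_fourier_mul_eq {f g : E → ℂ} (hf : Integrable f) (hg : Integrable g) :
    ∫ x, 𝓕 f x • g x = ∫ x, f x • 𝓕 g x := by
  have := VectorFourier.integral_fourierIntegral_smul_eq_flip (μ := (volume : Measure E))
    (ν := (volume : Measure E)) (L := (innerSL ℝ (E := E)).toLinearMap₁₂)
    Real.continuous_fourierChar (innerSL ℝ).continuous₂ hf hg
  have h2 : (innerSL ℝ (E := E)).toLinearMap₁₂.flip = (innerSL ℝ (E := E)).toLinearMap₁₂ := by
    ext x y
    exact real_inner_comm _ _
  rw [h2] at this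
  exact this

/-- On integrable functions the Fourier transform of `L²` is given by the Fourier integral. -/
theorem coeFn_fourier_toLp {f : E → ℂ} (hf : Integrable f) (hf2 : MemLp f 2) :
    (𝓕 (hf2.toLp f) : Lp ℂ 2 (volume : Measure E)) =ᵐ[volume] 𝓕 f := by
  refine ae_eq_of_integral_contDiff_smul_eq
    ((Lp.memLp _).locallyIntegrable (by norm_num)) (continuous_fourier hf).locallyIntegrable ?_
  intro g hg hgc
  have hg₁ : HasCompactSupport (Complex.ofRealCLM ∘ g) := hgc.comp_left rfl
  have hg₂ : ContDiff ℝ ∞ (Complex.ofRealCLM ∘ g) := by fun_prop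
  -- The transform on L² agrees with that of tempered distributions, which moves onto the test
  -- function; by Fubini the Fourier integral of f obeys the same rule.
  set G := hg₁.toSchwartzMap hg₂ with hG
  have h1 := DFunLike.congr_fun (Lp.fourier_toTemperedDistribution_eq (hf2.toLp f)) G
  rw [TemperedDistribution.fourier_apply, Lp.toTemperedDistribution_apply,
    Lp.toTemperedDistribution_apply] at h1
  have h2 : ∀ x, G x = (g x : ℂ) := fun x => rfl
  calc ∫ x, g x • (𝓕 (hf2.toLp f) : Lp ℂ 2 (volume : Measure E)) x
      = ∫ x, G x • (𝓕 (hf2.toLp f) : Lp ℂ 2 (volume : Measure E)) x := by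
        simp [h2]
    _ = ∫ x, (𝓕 G) x • (hf2.toLp f : Lp ℂ 2 (volume : Measure E)) x := h1.symm
    _ = ∫ x, 𝓕 (G : E → ℂ) x • f x := by
        rw [SchwartzMap.fourier_coe]
        refine integral_congr_ae ?_
        filter_upwards [hf2.coeFn_toLp] with x hx
        rw [hx]
    _ = ∫ x, G x • 𝓕 f x := integral_fourier_mul_eq G.integrable hf
    _ = ∫ x, g x • 𝓕 f x := by simp [h2]

theorem memLp_fourier {f : E → ℂ} (hf : Integrable f) (hf2 : MemLp f 2) :
    MemLp (𝓕 f) 2 :=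
  (memLp_congr_ae (coeFn_fourier_toLp hf hf2)).1 (Lp.memLp _)

theorem inner_fourier {f g : E → ℂ} (hf : Integrable f) (hf2 : MemLp f 2)
    (hg : Integrable g) (hg2 : MemLp g 2) :
    ∫ x, inner ℂ (𝓕 f x) (𝓕 g x) = ∫ x, inner ℂ (f x) (g x) := by
  have h := Lp.inner_fourier_eq (hf2.toLp f) (hg2.toLp g)
  rw [L2.inner_def, L2.inner_def] at h
  convert h using 1
  · refine integral_congr_ae ?_
    filter_upwards [coeFn_fourier_toLp hf hf2, coeFn_fourier_toLp hg hg2] with x h1 h2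
    rw [h1, h2]
  · refine integral_congr_ae ?_
    filter_upwards [hf2.coeFn_toLp, hg2.coeFn_toLp] with x h1 h2
    rw [h1, h2]

theorem integral_norm_fourier_sq {f : E → ℂ} (hf : Integrable f) (hf2 : MemLp f 2) :
    ∫ x, ‖𝓕 f x‖ ^ 2 = ∫ x, ‖f x‖ ^ 2 := by
  have h := inner_fourier hf hf2 hf hf2
  simp only [inner_self_eq_norm_sq_to_K] at h
  have h3 : ∀ u : E → ℂ, ∫ x, ((‖u x‖ : ℂ)) ^ 2 = ((∫ x, ‖u x‖ ^ 2 : ℝ) : ℂ) := by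
    intro u
    rw [← integral_complex_ofReal]
    simp
  have h' := h
  simp only [Complex.coe_algebraMap] at h'
  rw [h3, h3] at h'
  exact_mod_cast h'

theorem sq_integral_mul_le {α : Type*} [MeasurableSpace α] {μ : Measure α} {f g : α → ℝ}
    (hf : MemLp f 2 μ) (hg : MemLp g 2 μ) :
    (∫ x, f x * g x ∂μ) ^ 2 ≤ (∫ x, f x ^ 2 ∂μ) * ∫ x, g x ^ 2 ∂μ := by
  have h := real_inner_mul_inner_self_le (hf.toLp f) (hg.toLp g)
  have key : ∀ {u v : α → ℝ} (hu : MemLp u 2 μ) (hv : MemLp v 2 μ),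
      inner ℝ (hu.toLp u) (hv.toLp v) = ∫ x, u x * v x ∂μ := by
    intro u v hu hv
    rw [L2.inner_def]
    refine integral_congr_ae ?_
    filter_upwards [hu.coeFn_toLp, hv.coeFn_toLp] with x h1 h2
    rw [h1, h2]
    simp [mul_comm]
  rw [key, key, key] at h
  simpa [sq] using h

end Plancherel

/-! ### Mass on a set of finite measure, by splitting frequencies. -/

section Localization

variable {E : Type*} [NormedAddCommGroup E] [InnerProductSpace ℝ E] [FiniteDimensional ℝ E]
  [MeasurableSpace E] [BorelSpace E]

theorem sq_integral_norm_le {α F : Type*} [MeasurableSpace α] [NormedAddCommGroup F]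
    {μ : Measure α} [IsFiniteMeasure μ] {f : α → F} (hf : MemLp f 2 μ) :
    (∫ x, ‖f x‖ ∂μ) ^ 2 ≤ μ.real univ * ∫ x, ‖f x‖ ^ 2 ∂μ := by
  have := sq_integral_mul_le (f := fun _ : α => (1 : ℝ)) (memLp_const 1) hf.norm
  simpa using this

/-- The mass of `f` on a set `A` of small measure is controlled by its low frequencies in `L¹`
and by its high frequencies in `L²`. -/
theorem setIntegral_norm_sq_le {f : E → ℂ} (hf : Integrable f) (hf2 : MemLp f 2) {A S : Set E}
    (hA : MeasurableSet A) (hAf : volume A ≠ ⊤) (hS : MeasurableSet S) (hSf : volume S ≠ ⊤) :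
    ∫ x in A, ‖f x‖ ^ 2 ≤ 2 * (volume.real A * (∫ ξ in S, ‖𝓕 f ξ‖) ^ 2
      + ∫ ξ in Sᶜ, ‖𝓕 f ξ‖ ^ 2) := by
  have : IsFiniteMeasure (volume.restrict A) := ⟨by simpa using hAf.lt_top⟩
  have : IsFiniteMeasure (volume.restrict S) := ⟨by simpa using hSf.lt_top⟩
  set I := ∫ x in A, ‖f x‖ ^ 2 with hI
  have hI0 : 0 ≤ I := integral_nonneg fun x => by positivity
  -- Duality: I = ⟨g, f⟩ = ⟨ĝ, f̂⟩. On S, |ĝ| ≤ ‖g‖₁ ≤ (|A| I)^{1/2}; off S, Cauchy–Schwarz is used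
  -- with ‖ĝ‖₂² = I. After squaring, one factor I cancels.
  set g := A.indicator f with hg
  have hg1 : Integrable g := hf.indicator hA
  have hg2 : MemLp g 2 := hf2.indicator hA
  have hF2 := memLp_fourier hf hf2
  have hG2 := memLp_fourier hg1 hg2
  have e1 : ∫ x, ‖𝓕 g x‖ ^ 2 = I := by
    rw [integral_norm_fourier_sq hg1 hg2, hI, ← integral_indicator hA]
    refine integral_congr_ae (Filter.Eventually.of_forall fun x => ?_)
    by_cases hx : x ∈ A <;> simp [hg, hx]
  have e2 : ∫ x, inner ℂ (g x) (f x) = (I : ℂ) := by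
    rw [hI, ← integral_indicator hA, ← integral_complex_ofReal]
    refine integral_congr_ae (Filter.Eventually.of_forall fun x => ?_)
    by_cases hx : x ∈ A <;> simp [hg, hx, inner_self_eq_norm_sq_to_K, -RCLike.inner_apply]
  have e3 : ∫ x, ‖g x‖ = ∫ x in A, ‖f x‖ := by
    rw [← integral_indicator hA]
    refine integral_congr_ae (Filter.Eventually.of_forall fun x => ?_)
    by_cases hx : x ∈ A <;> simp [hg, hx]
  have hprod : Integrable fun x => ‖𝓕 g x‖ * ‖𝓕 f x‖ := hG2.norm.integrable_mul hF2.norm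
  have e4 : I ≤ ∫ x, ‖𝓕 g x‖ * ‖𝓕 f x‖ := by
    have h1 : ‖∫ x, inner ℂ (𝓕 g x) (𝓕 f x)‖ = I := by
      rw [inner_fourier hg1 hg2 hf hf2, e2, Complex.norm_real, Real.norm_of_nonneg hI0]
    rw [← h1]
    exact norm_integral_le_of_norm_le hprod
      (Filter.Eventually.of_forall fun x => norm_inner_le_norm _ _)
  have hFS : IntegrableOn (fun ξ => ‖𝓕 f ξ‖) S :=
    (hF2.norm.restrict S).integrable (by norm_num)
  set a := ∫ ξ in S, ‖𝓕 f ξ‖ with ha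
  have ha0 : 0 ≤ a := integral_nonneg fun x => by positivity
  set b := ∫ ξ in Sᶜ, ‖𝓕 f ξ‖ ^ 2 with hb
  have hb0 : 0 ≤ b := integral_nonneg fun x => by positivity
  set n := ∫ x in A, ‖f x‖ with hn
  have hn0 : 0 ≤ n := integral_nonneg fun x => by positivity
  have hnI : n ^ 2 ≤ volume.real A * I := by
    simpa using sq_integral_norm_le (hf2.restrict A)
  have e5 : ∫ x in S, ‖𝓕 g x‖ * ‖𝓕 f x‖ ≤ n * a := by
    rw [ha, ← integral_const_mul]
    refine integral_mono hprod.integrableOn (hFS.const_mul _) fun x => ?_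
    exact mul_le_mul_of_nonneg_right (e3 ▸ norm_fourier_le g x) (norm_nonneg _)
  set d := ∫ x in Sᶜ, ‖𝓕 g x‖ * ‖𝓕 f x‖ with hd
  have hd0 : 0 ≤ d := integral_nonneg fun x => by positivity
  have e6 : d ^ 2 ≤ I * b := by
    refine (sq_integral_mul_le (hG2.norm.restrict Sᶜ) (hF2.norm.restrict Sᶜ)).trans ?_
    refine mul_le_mul_of_nonneg_right ?_ hb0
    rw [← e1]
    exact setIntegral_le_integral (hG2.integrable_norm_pow (by norm_num))
      (Filter.Eventually.of_forall fun x => by positivity)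
  have e7 : I ≤ n * a + d := by
    refine e4.trans ?_
    rw [← integral_add_compl hS hprod]
    linarith
  have e8 : I ^ 2 ≤ I * (2 * (volume.real A * a ^ 2 + b)) := by
    have h1 : I ^ 2 ≤ (n * a + d) ^ 2 := pow_le_pow_left₀ hI0 e7 2
    have h2 : (n * a + d) ^ 2 ≤ 2 * (n ^ 2 * a ^ 2 + d ^ 2) := by
      nlinarith [sq_nonneg (n * a - d)]
    have h3 : n ^ 2 * a ^ 2 ≤ volume.real A * I * a ^ 2 :=
      mul_le_mul_of_nonneg_right hnI (sq_nonneg _)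
    nlinarith
  rcases hI0.eq_or_lt with h0 | h0
  · rw [← h0]; positivity
  · rw [sq] at e8
    exact le_of_mul_le_mul_left e8 h0

theorem fourier_iteratedFDeriv_apply_const {m : ℕ} {φ : E → ℝ} (hφ : ContDiff ℝ m φ)
    (hc : HasCompactSupport φ) (e ξ : E) :
    𝓕 (fun x => ((iteratedFDeriv ℝ m φ x fun _ => e : ℝ) : ℂ)) ξ =
      (2 * Real.pi * Complex.I * (inner ℝ ξ e : ℝ)) ^ m * 𝓕 (fun x => (φ x : ℂ)) ξ := by
  have hf : ContDiff ℝ m (fun x => (φ x : ℂ)) := Complex.ofRealCLM.contDiff.comp hφ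
  have hfc : HasCompactSupport (fun x => (φ x : ℂ)) := hc.comp_left (g := Complex.ofReal) rfl
  have hint : ∀ n : ℕ, (n : ℕ∞) ≤ m → Integrable (iteratedFDeriv ℝ n (fun x => (φ x : ℂ))) := by
    intro n hn
    exact (hf.continuous_iteratedFDeriv (by exact_mod_cast hn)).integrable_of_hasCompactSupport
      (hfc.iteratedFDeriv n)
  have h := Real.fourier_iteratedFDeriv (N := m) hf hint (n := m) le_rfl
  have h1 : ∀ x, ((iteratedFDeriv ℝ m φ x fun _ => e : ℝ) : ℂ) =
      iteratedFDeriv ℝ m (fun x => (φ x : ℂ)) x fun _ => e := by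
    intro x
    have := Complex.ofRealCLM.iteratedFDeriv_comp_left (f := φ) (x := x) hφ.contDiffAt le_rfl
    have h2 : (fun x => (φ x : ℂ)) = Complex.ofRealCLM ∘ φ := rfl
    rw [h2, this]
    rfl
  simp_rw [h1]
  rw [← Real.fourier_continuousMultilinearMap_apply (hint m le_rfl), h]
  rw [VectorFourier.fourierPowSMulRight_apply, Finset.prod_const, Finset.card_univ,
    Fintype.card_fin]
  have h3 : (-innerSL ℝ) ξ e = -inner ℝ ξ e := rfl
  rw [h3, Complex.real_smul, smul_eq_mul, ← mul_assoc]
  push_cast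
  rw [← mul_pow]
  congr 2
  ring

end Localization

/-! ### Fourier estimates and Poincaré's inequality for test functions. -/

section TestFunctions

variable {N : ℕ}

/-- The pure derivative `∂_i^m φ`. -/
def pureD (m : ℕ) (i : Fin N) (φ : Sp N → ℝ) (x : Sp N) : ℝ :=
  iteratedFDeriv ℝ m φ x fun _ => EuclideanSpace.single i 1

/-- The energy `∑_i ∫ |∂_i^m φ|²`. -/
def pureEnergy (m : ℕ) (φ : Sp N → ℝ) : ℝ := ∑ i, ∫ x, pureD m i φ x ^ 2

theorem pureEnergy_nonneg (m : ℕ) (φ : Sp N → ℝ) : 0 ≤ pureEnergy m φ :=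
  Finset.sum_nonneg fun _ _ => integral_nonneg fun _ => sq_nonneg _

/-- The power mean inequality. Because of it the pure derivatives ∂_i^m alone control |ξ|^{2m}
|φ̂|², and mixed derivatives are not needed. -/
theorem norm_pow_le (m : ℕ) (hN : 1 ≤ N) (ξ : Sp N) :
    ‖ξ‖ ^ (2 * m) ≤ (N : ℝ) ^ m * ∑ i, |ξ i| ^ (2 * m) := by
  have hN0 : (1 : ℝ) ≤ N := by exact_mod_cast hN
  rcases m with _ | m
  · simpa using hN0
  rw [pow_mul, EuclideanSpace.norm_sq_eq]
  have h := pow_sum_div_card_le_sum_pow (s := (Finset.univ : Finset (Fin N)))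
    (f := fun i => ‖ξ i‖ ^ 2) (fun i _ => by positivity) m
  rw [div_le_iff₀ (by simp; positivity)] at h
  refine h.trans ?_
  simp only [Finset.card_univ, Fintype.card_fin, ← pow_mul, Real.norm_eq_abs]
  rw [mul_comm]
  refine mul_le_mul_of_nonneg_right (pow_le_pow_right₀ hN0 (Nat.le_succ m)) ?_
  exact Finset.sum_nonneg fun i _ => by positivity

variable {m : ℕ} {φ : Sp N → ℝ}

theorem continuous_pureD (hφ : ContDiff ℝ m φ) (i : Fin N) : Continuous (pureD m i φ) :=
  (ContinuousMultilinearMap.apply ℝ _ _ _).continuous.comp (hφ.continuous_iteratedFDeriv le_rfl)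

theorem hasCompactSupport_pureD (hc : HasCompactSupport φ) (i : Fin N) :
    HasCompactSupport (pureD m i φ) :=
  (hc.iteratedFDeriv m).comp_left
    (g := fun T : ContinuousMultilinearMap ℝ (fun _ : Fin m => Sp N) ℝ =>
      T fun _ => EuclideanSpace.single i 1) rfl

theorem memLp_ofReal {g : Sp N → ℝ} (hg : Continuous g) (hc : HasCompactSupport g)
    (p : ENNReal) : MemLp (fun x => (g x : ℂ)) p :=
  (Complex.continuous_ofReal.comp hg).memLp_of_hasCompactSupport
    (hc.comp_left (g := Complex.ofReal) rfl)

theorem integral_norm_fourier_ofReal_sq {g : Sp N → ℝ} (hg : Continuous g)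
    (hc : HasCompactSupport g) :
    ∫ ξ, ‖𝓕 (fun x => (g x : ℂ)) ξ‖ ^ 2 = ∫ x, g x ^ 2 := by
  rw [integral_norm_fourier_sq (memLp_one_iff_integrable.1 (memLp_ofReal hg hc 1))
    (memLp_ofReal hg hc 2)]
  simp

/-- The Fourier side of the energy. -/
theorem integral_norm_pow_mul_fourier_le (hN : 1 ≤ N) (hφ : ContDiff ℝ m φ)
    (hc : HasCompactSupport φ) :
    Integrable (fun ξ => ‖ξ‖ ^ (2 * m) * ‖𝓕 (fun x => (φ x : ℂ)) ξ‖ ^ 2) ∧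
    ∫ ξ, ‖ξ‖ ^ (2 * m) * ‖𝓕 (fun x => (φ x : ℂ)) ξ‖ ^ 2 ≤ (N : ℝ) ^ m * pureEnergy m φ := by
  set F := 𝓕 (fun x => (φ x : ℂ)) with hF
  have hFc : Continuous F :=
    continuous_fourier (memLp_one_iff_integrable.1 (memLp_ofReal hφ.continuous hc 1))
  have hD : ∀ i, Integrable fun ξ => ‖𝓕 (fun x => (pureD m i φ x : ℂ)) ξ‖ ^ 2 := fun i =>
    (memLp_fourier (memLp_one_iff_integrable.1
      (memLp_ofReal (continuous_pureD hφ i) (hasCompactSupport_pureD hc i) 1))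
      (memLp_ofReal (continuous_pureD hφ i)
        (hasCompactSupport_pureD hc i) 2)).integrable_norm_pow (by norm_num)
  have hpt : ∀ ξ, ‖ξ‖ ^ (2 * m) * ‖F ξ‖ ^ 2 ≤
      (N : ℝ) ^ m * ∑ i, ‖𝓕 (fun x => (pureD m i φ x : ℂ)) ξ‖ ^ 2 := by
    intro ξ
    calc ‖ξ‖ ^ (2 * m) * ‖F ξ‖ ^ 2 ≤ ((N : ℝ) ^ m * ∑ i, |ξ i| ^ (2 * m)) * ‖F ξ‖ ^ 2 :=
          mul_le_mul_of_nonneg_right (norm_pow_le m hN ξ) (sq_nonneg _)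
      _ = (N : ℝ) ^ m * ∑ i, |ξ i| ^ (2 * m) * ‖F ξ‖ ^ 2 := by
          rw [mul_assoc, Finset.sum_mul]
      _ ≤ _ := by
          refine mul_le_mul_of_nonneg_left (Finset.sum_le_sum fun i _ => ?_) (by positivity)
          simp only [pureD]
          rw [fourier_iteratedFDeriv_apply_const hφ hc, norm_mul, mul_pow, norm_pow, ← pow_mul,
            mul_comm m 2]
          refine mul_le_mul_of_nonneg_right (pow_le_pow_left₀ (abs_nonneg _) ?_ _) (sq_nonneg _)
          have h1 : inner ℝ ξ (EuclideanSpace.single i (1 : ℝ)) = ξ i := by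
            simp [EuclideanSpace.inner_single_right]
          rw [h1, norm_mul, norm_mul, norm_mul, Complex.norm_I, Complex.norm_real,
            Complex.norm_real, Real.norm_of_nonneg Real.pi_pos.le, Real.norm_eq_abs]
          -- The factor 2π brought by differentiation exceeds 1 and is discarded.
          have := Real.pi_gt_three
          norm_num
          nlinarith [abs_nonneg (ξ i)]
  have hint : Integrable fun ξ => (N : ℝ) ^ m *
      ∑ i, ‖𝓕 (fun x => (pureD m i φ x : ℂ)) ξ‖ ^ 2 :=
    (integrable_finsetSum _ fun i _ => hD i).const_mul _
  have hI : Integrable (fun ξ => ‖ξ‖ ^ (2 * m) * ‖F ξ‖ ^ 2) := by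
    refine hint.mono' (by fun_prop) (Filter.Eventually.of_forall fun ξ => ?_)
    rw [Real.norm_of_nonneg (by positivity)]
    exact hpt ξ
  refine ⟨hI, (integral_mono hI hint hpt).trans_eq ?_⟩
  rw [integral_const_mul, integral_finsetSum _ fun i _ => hD i, pureEnergy]
  congr 1
  exact Finset.sum_congr rfl fun i _ =>
    integral_norm_fourier_ofReal_sq (continuous_pureD hφ i) (hasCompactSupport_pureD hc i)

theorem setIntegral_compl_ball_fourier_le (hN : 1 ≤ N) (hφ : ContDiff ℝ m φ)
    (hc : HasCompactSupport φ) {r : ℝ} (hr : 0 < r) :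
    ∫ ξ in (Metric.ball (0 : Sp N) r)ᶜ, ‖𝓕 (fun x => (φ x : ℂ)) ξ‖ ^ 2 ≤
      (r ^ (2 * m))⁻¹ * ((N : ℝ) ^ m * pureEnergy m φ) := by
  obtain ⟨hI, hle⟩ := integral_norm_pow_mul_fourier_le hN hφ hc
  refine le_trans ?_ (mul_le_mul_of_nonneg_left hle (by positivity))
  rw [← integral_const_mul]
  refine le_trans ?_ (setIntegral_le_integral (hI.const_mul _)
    (s := (Metric.ball (0 : Sp N) r)ᶜ) (Filter.Eventually.of_forall fun x => by positivity))
  refine setIntegral_mono_on (memLp_fourier (memLp_one_iff_integrable.1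
    (memLp_ofReal hφ.continuous hc 1)) (memLp_ofReal hφ.continuous hc
      2)|>.integrable_norm_pow (by norm_num)).integrableOn (hI.const_mul _).integrableOn
    measurableSet_ball.compl fun ξ hξ => ?_
  rw [← mul_assoc]
  refine le_mul_of_one_le_left (by positivity) ?_
  have h1 : r ≤ ‖ξ‖ := by simpa using hξ
  rw [inv_mul_eq_div, one_le_div (by positivity)]
  exact pow_le_pow_left₀ hr.le h1 _

theorem sq_integral_abs_le {Ω : Set (Sp N)} (hΩb : Bornology.IsBounded Ω)
    (hφ : Continuous φ) (hc : HasCompactSupport φ) (hs : tsupport φ ⊆ Ω) :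
    (∫ x, ‖(φ x : ℂ)‖) ^ 2 ≤ volume.real Ω * ∫ x, φ x ^ 2 := by
  have : IsFiniteMeasure (volume.restrict Ω) := ⟨by simpa using hΩb.measure_lt_top⟩
  have hz : ∀ x, x ∉ Ω → φ x = 0 := fun x hx => image_eq_zero_of_notMem_tsupport fun h => hx (hs h)
  have h := sq_integral_norm_le ((memLp_ofReal hφ hc 2).restrict Ω)
  rw [setIntegral_eq_integral_of_forall_compl_eq_zero (fun x hx => by simp [hz x hx]),
    setIntegral_eq_integral_of_forall_compl_eq_zero (fun x hx => by simp [hz x hx])] at h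
  simpa using h

theorem volume_real_ball {r : ℝ} (hr : 0 < r) :
    volume.real (Metric.ball (0 : Sp N) r) = r ^ N * volume.real (Metric.ball (0 : Sp N) 1) := by
  simp only [Measure.real]
  rw [Measure.addHaar_ball_of_pos _ _ hr]
  simp [ENNReal.toReal_mul, hr.le]

/-- The bound passes through ‖φ‖₁, which the bounded support compares with ‖φ‖₂. It is uniform in ξ,
so integrating it over a small ball costs only the volume of the ball. -/
theorem setIntegral_ball_fourier_le (hφ : Continuous φ)
    (hc : HasCompactSupport φ) {Ω : Set (Sp N)} (hΩb : Bornology.IsBounded Ω)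
    (hs : tsupport φ ⊆ Ω) (ξ : Sp N) :
    ‖𝓕 (fun x => (φ x : ℂ)) ξ‖ ^ 2 ≤ volume.real Ω * ∫ x, φ x ^ 2 :=
  (pow_le_pow_left₀ (norm_nonneg _) (norm_fourier_le _ ξ) 2).trans
    (sq_integral_abs_le hΩb hφ hc hs)

/-- Poincaré's inequality for test functions. -/
theorem exists_poincare_testFunction (hN : 1 ≤ N) (m : ℕ) {Ω : Set (Sp N)}
    (hΩb : Bornology.IsBounded Ω) :
    ∃ K : ℝ, 0 ≤ K ∧ ∀ φ : Sp N → ℝ, ContDiff ℝ m φ → HasCompactSupport φ → tsupport φ ⊆ Ω →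
      ∫ x, φ x ^ 2 ≤ K * pureEnergy m φ := by
  set V := volume.real Ω with hV
  have hV0 : 0 ≤ V := measureReal_nonneg
  set c := volume.real (Metric.ball (0 : Sp N) 1) with hcdef
  have hc0 : 0 ≤ c := measureReal_nonneg
  -- The radius makes |B_r| V ≤ 1/2 (using r^N ≤ r), so that the frequencies below r carry at most
  -- half of ‖φ‖₂² and can be absorbed.
  set r : ℝ := 1 / (1 + 2 * V * c) with hr
  have hd : 0 < 1 + 2 * V * c := by positivity
  have hr0 : 0 < r := by positivity
  have hr1 : r ≤ 1 := by rw [hr, div_le_one hd]; nlinarith [mul_nonneg hV0 hc0]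
  refine ⟨2 * ((r ^ (2 * m))⁻¹ * (N : ℝ) ^ m), by positivity, fun φ hφ hc hs => ?_⟩
  have hI := memLp_fourier (memLp_one_iff_integrable.1 (memLp_ofReal hφ.continuous hc 1))
    (memLp_ofReal hφ.continuous hc 2)|>.integrable_norm_pow (by norm_num)
  have h1 := setIntegral_compl_ball_fourier_le hN hφ hc hr0
  have h0 : 0 ≤ ∫ x, φ x ^ 2 := integral_nonneg fun x => sq_nonneg _
  have h2 : ∫ ξ in Metric.ball (0 : Sp N) r, ‖𝓕 (fun x => (φ x : ℂ)) ξ‖ ^ 2 ≤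
      volume.real (Metric.ball (0 : Sp N) r) * (V * ∫ x, φ x ^ 2) := by
    have hfin : IsFiniteMeasure (volume.restrict (Metric.ball (0 : Sp N) r)) :=
      ⟨by simpa using measure_ball_lt_top⟩
    refine (integral_mono hI.integrableOn (integrable_const (V * ∫ x, φ x ^ 2))
      fun ξ => setIntegral_ball_fourier_le hφ.continuous hc hΩb hs ξ).trans_eq ?_
    simp
  have h3 : volume.real (Metric.ball (0 : Sp N) r) * V ≤ 1 / 2 := by
    rw [volume_real_ball hr0]
    have : r ^ N ≤ r := by
      simpa using pow_le_pow_of_le_one hr0.le hr1 hN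
    have h4 : r * (1 + 2 * V * c) = 1 := by rw [hr]; field_simp
    have h5 : r ^ N * c * V ≤ r * (c * V) := by
      rw [mul_assoc]; exact mul_le_mul_of_nonneg_right this (by positivity)
    nlinarith
  have h4 : ∫ x, φ x ^ 2 = (∫ ξ in Metric.ball (0 : Sp N) r, ‖𝓕 (fun x => (φ x : ℂ)) ξ‖ ^ 2) +
      ∫ ξ in (Metric.ball (0 : Sp N) r)ᶜ, ‖𝓕 (fun x => (φ x : ℂ)) ξ‖ ^ 2 := by
    rw [integral_add_compl measurableSet_ball hI, integral_norm_fourier_ofReal_sq hφ.continuous hc]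
  have h5 : volume.real (Metric.ball (0 : Sp N) r) * (V * ∫ x, φ x ^ 2) ≤
      1 / 2 * ∫ x, φ x ^ 2 := by
    rw [← mul_assoc]; exact mul_le_mul_of_nonneg_right h3 h0
  nlinarith

/-- The growth `∫_1^R y^{N - 1 - 2m} dy` of the low frequency part. -/
def lowFreq (N m : ℕ) (R : ℝ) : ℝ := ∫ y in Ico 1 R, y ^ (N - 1) * (y ^ (2 * m))⁻¹

theorem lowFreq_nonneg (N m : ℕ) (R : ℝ) : 0 ≤ lowFreq N m R :=
  setIntegral_nonneg measurableSet_Ico fun y hy => by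
    have : 0 ≤ y := zero_le_one.trans hy.1
    positivity

/-- Polar coordinates. The annulus starts at radius 1 because |ξ|^{-2m} is not integrable at the
origin when 2m ≥ N; the unit ball is left to Poincaré's inequality. -/
theorem setIntegral_annulus (hN : 1 ≤ N) (m : ℕ) (R : ℝ) :
    ∫ ξ in Metric.ball (0 : Sp N) R \ Metric.ball 0 1, (‖ξ‖ ^ (2 * m))⁻¹ =
      N * volume.real (Metric.ball (0 : Sp N) 1) * lowFreq N m R := by
  have : Nonempty (Fin N) := ⟨⟨0, hN⟩⟩
  have hne : Nontrivial (Sp N) := inferInstance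
  have h := integral_fun_norm_addHaar (volume : Measure (Sp N))
    ((Ico (1 : ℝ) R).indicator fun y => (y ^ (2 * m))⁻¹)
  rw [← integral_indicator (measurableSet_ball.diff measurableSet_ball)]
  convert h using 1
  · refine integral_congr_ae (Filter.Eventually.of_forall fun ξ => ?_)
    simp only [indicator, mem_sdiff, Metric.mem_ball, dist_zero_right, not_lt, mem_Ico]
    simp only [and_comm]
  · simp only [finrank_euclideanSpace, Fintype.card_fin, smul_eq_mul, nsmul_eq_mul, lowFreq]
    rw [← integral_indicator measurableSet_Ico, ← integral_indicator measurableSet_Ioi, mul_assoc]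
    congr 2
    refine integral_congr_ae (Filter.Eventually.of_forall fun y => ?_)
    by_cases hy : y ∈ Ico 1 R
    · have : y ∈ Ioi (0 : ℝ) := lt_of_lt_of_le one_pos hy.1
      simp [hy, this]
    · by_cases h0 : y ∈ Ioi (0 : ℝ) <;> simp [hy, h0]

end TestFunctions

/-! ### The localized inequality for test functions. -/

section TestFunctionBound

variable {N m : ℕ} {φ : Sp N → ℝ}

/-- Cauchy–Schwarz after writing |φ̂| = |ξ|^{-m} · |ξ|^m |φ̂|. -/
theorem sq_setIntegral_annulus_fourier_le (hN : 1 ≤ N) (hφ : ContDiff ℝ m φ)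
    (hc : HasCompactSupport φ) (R : ℝ) :
    (∫ ξ in Metric.ball (0 : Sp N) R \ Metric.ball 0 1, ‖𝓕 (fun x => (φ x : ℂ)) ξ‖) ^ 2 ≤
      N * volume.real (Metric.ball (0 : Sp N) 1) * lowFreq N m R *
        ((N : ℝ) ^ m * pureEnergy m φ) := by
  obtain ⟨hI, hle⟩ := integral_norm_pow_mul_fourier_le hN hφ hc
  set F := 𝓕 (fun x => (φ x : ℂ)) with hF
  have hFc : Continuous F :=
    continuous_fourier (memLp_one_iff_integrable.1 (memLp_ofReal hφ.continuous hc 1))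
  set S := Metric.ball (0 : Sp N) R \ Metric.ball 0 1 with hS
  have hSm : MeasurableSet S := measurableSet_ball.diff measurableSet_ball
  have hfin : IsFiniteMeasure (volume.restrict S) :=
    ⟨by simpa using (measure_mono sdiff_subset).trans_lt measure_ball_lt_top⟩
  have hS1 : ∀ ξ ∈ S, 1 ≤ ‖ξ‖ := fun ξ hξ => by simpa [hS] using hξ.2
  have hg : MemLp (fun ξ => ‖ξ‖ ^ m * ‖F ξ‖) 2 (volume.restrict S) := by
    refine (memLp_two_iff_integrable_sq (by fun_prop)).2 ?_
    refine (hI.integrableOn (s := S)).congr (Filter.Eventually.of_forall fun ξ => ?_)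
    simp only
    ring
  have hf : MemLp (fun ξ : Sp N => (‖ξ‖ ^ m)⁻¹) 2 (volume.restrict S) := by
    refine MemLp.of_bound (C := 1) (by fun_prop) ?_
    refine (ae_restrict_iff' hSm).2 (Filter.Eventually.of_forall fun ξ hξ => ?_)
    rw [Real.norm_of_nonneg (by positivity)]
    exact inv_le_one_of_one_le₀ (one_le_pow₀ (hS1 ξ hξ))
  have h := sq_integral_mul_le hf hg
  have e1 : ∫ ξ in S, (‖ξ‖ ^ m)⁻¹ * (‖ξ‖ ^ m * ‖F ξ‖) = ∫ ξ in S, ‖F ξ‖ := by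
    refine setIntegral_congr_fun hSm fun ξ hξ => ?_
    have : 0 < ‖ξ‖ := one_pos.trans_le (hS1 ξ hξ)
    field_simp
  have e2 : ∫ ξ in S, ((‖ξ‖ ^ m)⁻¹) ^ 2 =
      N * volume.real (Metric.ball (0 : Sp N) 1) * lowFreq N m R := by
    rw [← setIntegral_annulus hN]
    refine setIntegral_congr_fun hSm fun ξ hξ => ?_
    rw [inv_pow, ← pow_mul, mul_comm m 2]
  have e3 : ∫ ξ in S, (‖ξ‖ ^ m * ‖F ξ‖) ^ 2 ≤ (N : ℝ) ^ m * pureEnergy m φ := by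
    refine le_trans ?_ hle
    have : ∀ ξ, (‖ξ‖ ^ m * ‖F ξ‖) ^ 2 = ‖ξ‖ ^ (2 * m) * ‖F ξ‖ ^ 2 := fun ξ => by ring
    simp_rw [this]
    exact setIntegral_le_integral hI (Filter.Eventually.of_forall fun x => by positivity)
  rw [e1, e2] at h
  refine h.trans (mul_le_mul_of_nonneg_left e3 ?_)
  have := lowFreq_nonneg N m R
  positivity

/-- Three frequency zones: the unit ball (Poincaré) gives the term |A|, the annulus up to R gives
|A| `lowFreq N m R`, and the exterior gives R^{-2m}. The radius stays free, to be optimized against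
|A|. -/
theorem exists_setIntegral_testFunction_le (hN : 1 ≤ N) (m : ℕ) {Ω : Set (Sp N)}
    (hΩb : Bornology.IsBounded Ω) :
    ∃ K : ℝ, 0 ≤ K ∧ ∀ φ : Sp N → ℝ, ContDiff ℝ m φ → HasCompactSupport φ → tsupport φ ⊆ Ω →
      ∀ A : Set (Sp N), MeasurableSet A → volume A ≠ ⊤ → ∀ R : ℝ, 1 ≤ R →
      ∫ x in A, φ x ^ 2 ≤
        K * (volume.real A * (1 + lowFreq N m R) + (R ^ (2 * m))⁻¹) * pureEnergy m φ := by
  obtain ⟨P, hP0, hP⟩ := exists_poincare_testFunction hN m hΩb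
  set c := volume.real (Metric.ball (0 : Sp N) 1) with hcdef
  have hc0 : 0 ≤ c := measureReal_nonneg
  refine ⟨4 * (c * P + N * c * (N : ℝ) ^ m) + 2 * (N : ℝ) ^ m, by positivity,
    fun φ hφ hc hs A hA hAf R hR => ?_⟩
  have h1 : Integrable fun x => (φ x : ℂ) :=
    memLp_one_iff_integrable.1 (memLp_ofReal hφ.continuous hc 1)
  have h2 := memLp_ofReal hφ.continuous hc 2
  have hF2 := memLp_fourier h1 h2
  have hR0 : 0 < R := one_pos.trans_le hR
  have hmain := setIntegral_norm_sq_le h1 h2 hA hAf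
    (measurableSet_ball (x := (0 : Sp N)) (ε := R)) measure_ball_lt_top.ne
  have hhigh := setIntegral_compl_ball_fourier_le hN hφ hc hR0
  have hann := sq_setIntegral_annulus_fourier_le hN hφ hc R
  set F := 𝓕 (fun x => (φ x : ℂ)) with hF
  have hfin1 : IsFiniteMeasure (volume.restrict (Metric.ball (0 : Sp N) 1)) :=
    ⟨by simpa using measure_ball_lt_top⟩
  have hfinR : IsFiniteMeasure (volume.restrict (Metric.ball (0 : Sp N) R)) :=
    ⟨by simpa using measure_ball_lt_top⟩
  have hlow : (∫ ξ in Metric.ball (0 : Sp N) 1, ‖F ξ‖) ^ 2 ≤ c * (P * pureEnergy m φ) := by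
    refine (sq_integral_norm_le (hF2.restrict _)).trans ?_
    have : (volume.restrict (Metric.ball (0 : Sp N) 1)).real univ = c := by simp [hcdef]
    rw [this]
    refine mul_le_mul_of_nonneg_left ?_ hc0
    refine le_trans ?_ (hP φ hφ hc hs)
    rw [← integral_norm_fourier_ofReal_sq hφ.continuous hc]
    exact setIntegral_le_integral (hF2.integrable_norm_pow (by norm_num))
      (Filter.Eventually.of_forall fun x => by positivity)
  have hsplit : ∫ ξ in Metric.ball (0 : Sp N) R, ‖F ξ‖ =
      (∫ ξ in Metric.ball (0 : Sp N) 1, ‖F ξ‖) +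
        ∫ ξ in Metric.ball (0 : Sp N) R \ Metric.ball 0 1, ‖F ξ‖ := by
    have hsub : Metric.ball (0 : Sp N) 1 ⊆ Metric.ball 0 R := Metric.ball_subset_ball hR
    have hi : IntegrableOn (fun ξ => ‖F ξ‖) (Metric.ball (0 : Sp N) R) :=
      (hF2.norm.restrict _).integrable (by norm_num)
    rw [← setIntegral_union disjoint_sdiff_right (measurableSet_ball.diff measurableSet_ball)
      (hi.mono_set hsub) (hi.mono_set sdiff_subset), union_sdiff_cancel hsub]
  have e1 : ∀ x, ‖(φ x : ℂ)‖ ^ 2 = φ x ^ 2 := fun x => by simp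
  simp_rw [e1] at hmain
  refine hmain.trans ?_
  rw [hsplit]
  have hD := pureEnergy_nonneg m φ
  have hψ := lowFreq_nonneg N m R
  have hV : 0 ≤ volume.real A := measureReal_nonneg
  set a := ∫ ξ in Metric.ball (0 : Sp N) 1, ‖F ξ‖
  set b := ∫ ξ in Metric.ball (0 : Sp N) R \ Metric.ball 0 1, ‖F ξ‖
  set D := pureEnergy m φ
  set ψ := lowFreq N m R
  set V := volume.real A
  set B := (N : ℝ) ^ m with hB
  have hB0 : 0 ≤ B := by positivity
  have hr0 : 0 ≤ (R ^ (2 * m))⁻¹ := by positivity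
  set r := (R ^ (2 * m))⁻¹
  have h3 : (a + b) ^ 2 ≤ 2 * (c * (P * D) + N * c * ψ * (B * D)) := by
    nlinarith [sq_nonneg (a - b)]
  have h4 : V * (a + b) ^ 2 ≤ V * (2 * (c * (P * D) + N * c * ψ * (B * D))) :=
    mul_le_mul_of_nonneg_left h3 hV
  have hN0 : (0 : ℝ) ≤ N := by positivity
  have h5 : 2 * (V * (2 * (c * (P * D) + N * c * ψ * (B * D))) + r * (B * D)) ≤
      (4 * (c * P + N * c * B) + 2 * B) * (V * (1 + ψ) + r) * D := by
    have i1 : 0 ≤ c * P * V * ψ * D := by positivity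
    have i2 : 0 ≤ N * c * B * V * D := by positivity
    have i3 : 0 ≤ (c * P + N * c * B) * r * D := by positivity
    have i4 : 0 ≤ B * (V * (1 + ψ)) * D := by positivity
    nlinarith
  linarith

end TestFunctionBound

/-! ### Passage from test functions to W₀^{m,2}(Ω). -/

section Density

variable {N m : ℕ} {Ω : Set (Sp N)}

/-- The energy `∑_{|γ| = m} ‖D^γ v‖²`. -/
def topEnergy (v : Jets Ω m) : ℝ := ∑ γ ∈ topIdx N m, ‖v γ‖ ^ 2

theorem topEnergy_nonneg (v : Jets Ω m) : 0 ≤ topEnergy v :=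
  Finset.sum_nonneg fun _ _ => sq_nonneg _

theorem continuous_topEnergy : Continuous (topEnergy : Jets Ω m → ℝ) := by
  unfold topEnergy
  fun_prop

theorem norm_sq_eq_integral {α : Type*} [MeasurableSpace α] {μ : Measure α} (f : Lp ℝ 2 μ) :
    ‖f‖ ^ 2 = ∫ x, f x ^ 2 ∂μ := by
  rw [← real_inner_self_eq_norm_sq, L2.inner_def]
  exact integral_congr_ae (Filter.Eventually.of_forall fun x => by simp [sq])

theorem continuous_setIntegral_sq {α : Type*} [MeasurableSpace α] {μ : Measure α} (A : Set α) :
    Continuous fun f : Lp ℝ 2 μ => ∫ x in A, f x ^ 2 ∂μ := by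
  have h : ∀ f : Lp ℝ 2 μ, ∫ x in A, f x ^ 2 ∂μ =
      ‖LpToLpRestrictCLM α ℝ ℝ μ 2 A f‖ ^ 2 := by
    intro f
    rw [norm_sq_eq_integral]
    refine integral_congr_ae ?_
    filter_upwards [LpToLpRestrictCLM_coeFn ℝ A f] with x hx
    rw [hx]
  simp_rw [h]
  fun_prop

theorem classicalD_zero (φ : Sp N → ℝ) (x : Sp N) : classicalD (0 : Fin N → ℕ) φ x = φ x := by
  have : ∀ n : ℕ, n = 0 → ∀ d : Fin n → Sp N, iteratedFDeriv ℝ n φ x d = φ x := by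
    rintro _ rfl d
    exact iteratedFDeriv_zero_apply d
  exact this _ (by simp) _

theorem classicalD_single (i : Fin N) (φ : Sp N → ℝ) (x : Sp N) :
    classicalD (Pi.single i m) φ x = pureD m i φ x := by
  have h1 : dirs (Pi.single i m : Fin N → ℕ) = fun _ => EuclideanSpace.single i 1 := by
    funext j
    unfold dirs
    rcases hp : finSigmaFinEquiv.symm j with ⟨k, l⟩
    rcases eq_or_ne k i with rfl | hk
    · rfl
    · have := l.2
      simp [hk] at this
  have h2 : ∀ n : ℕ, n = m → iteratedFDeriv ℝ n φ x (fun _ => EuclideanSpace.single i 1) =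
      iteratedFDeriv ℝ m φ x (fun _ => EuclideanSpace.single i 1) := by
    rintro _ rfl
    rfl
  unfold classicalD pureD
  rw [h1]
  exact h2 _ (by simp)

/-- The multi-index `m e_i`. -/
def singleIdx (m : ℕ) (i : Fin N) : MIdx N m :=
  ⟨Pi.single i m, mem_multiIndices.2 (by simp)⟩

theorem pureEnergy_le_topEnergy (hm : 1 ≤ m) {v : Jets Ω m} {φ : Sp N → ℝ}
    (hs : tsupport φ ⊆ Ω)
    (h : ∀ γ : MIdx N m, v γ =ᵐ[volume.restrict Ω] classicalD γ.1 φ) :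
    pureEnergy m φ ≤ topEnergy v := by
  -- The multi-indices m e_i are distinct only because m ≥ 1; hence the pure energy is a partial sum
  -- of the full one.
  have hinj : Function.Injective (singleIdx m : Fin N → MIdx N m) := by
    intro i j hij
    have h1 := congrFun (congrArg Subtype.val hij) i
    by_contra hne
    simp [singleIdx, hne] at h1
    omega
  have e1 : ∀ i, ∫ x, pureD m i φ x ^ 2 = ‖v (singleIdx m i)‖ ^ 2 := by
    intro i
    rw [norm_sq_eq_integral, ← setIntegral_eq_integral_of_forall_compl_eq_zero (s := Ω)]
    · refine integral_congr_ae ?_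
      filter_upwards [h (singleIdx m i)] with x hx
      rw [hx]
      simp only [singleIdx, classicalD_single]
    · intro x hx
      have : iteratedFDeriv ℝ m φ x = 0 := by
        by_contra h0
        exact hx (hs (support_iteratedFDeriv_subset m h0))
      simp [pureD, this]
  unfold pureEnergy topEnergy
  simp_rw [e1]
  refine (Finset.sum_map Finset.univ ⟨singleIdx m, hinj⟩ fun γ => ‖v γ‖ ^ 2).symm.trans_le ?_
  refine Finset.sum_le_sum_of_subset_of_nonneg ?_ fun _ _ _ => sq_nonneg _
  intro γ hγ
  obtain ⟨i, -, rfl⟩ := Finset.mem_map.1 hγ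
  simp [topIdx, singleIdx]

/-- For fixed A and R both sides are continuous in the norm of W^{m,2}, so the inequality survives
the closure with the same constant. -/
theorem exists_setIntegral_le (hN : 1 ≤ N) (hm : 1 ≤ m) (hΩo : IsOpen Ω)
    (hΩb : Bornology.IsBounded Ω) :
    ∃ K : ℝ, 0 ≤ K ∧ ∀ (v : W0 Ω m) (A : Set (Sp N)),
      NullMeasurableSet A (volume.restrict Ω) → ∀ R : ℝ, 1 ≤ R →
      ∫ x in A, toL2 v x ^ 2 ∂volume.restrict Ω ≤
        K * ((volume.restrict Ω).real A * (1 + lowFreq N m R) + (R ^ (2 * m))⁻¹) *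
          topEnergy v.1 := by
  obtain ⟨K, hK0, hK⟩ := exists_setIntegral_testFunction_le hN m hΩb
  refine ⟨K, hK0, fun v A hA R hR => ?_⟩
  -- A null measurable set may be replaced by its measurable hull, which differs from it by a null
  -- set.
  wlog hAm : MeasurableSet A generalizing A
  · have h1 := this _ (measurableSet_toMeasurable (volume.restrict Ω) A).nullMeasurableSet
      (measurableSet_toMeasurable _ A)
    rw [setIntegral_congr_set hA.toMeasurable_ae_eq, measureReal_congr hA.toMeasurable_ae_eq] at h1
    exact h1
  set G : Jets Ω m → Prop := fun v => ∫ x in A, v (zeroIdx N m) x ^ 2 ∂volume.restrict Ω ≤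
        K * ((volume.restrict Ω).real A * (1 + lowFreq N m R) + (R ^ (2 * m))⁻¹) *
          topEnergy v with hG
  have hclosed : IsClosed {v | G v} :=
    isClosed_le ((continuous_setIntegral_sq A).comp (by fun_prop))
      (continuous_const.mul continuous_topEnergy)
  suffices h : ∀ v ∈ testJets Ω m, G v from
    (closure_minimal (s := (testJets Ω m : Set (Jets Ω m))) h hclosed) v.2
  rintro v ⟨φ, hφ, hc, hs, hv⟩
  have hfin : volume (A ∩ Ω) ≠ ⊤ :=
    ((measure_mono inter_subset_right).trans_lt hΩb.measure_lt_top).ne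
  have h1 := hK φ hφ hc hs (A ∩ Ω) (hAm.inter hΩo.measurableSet) hfin R hR
  have h2 : ∫ x in A, v (zeroIdx N m) x ^ 2 ∂volume.restrict Ω = ∫ x in A ∩ Ω, φ x ^ 2 := by
    rw [← Measure.restrict_restrict hAm]
    refine integral_congr_ae ?_
    filter_upwards [ae_restrict_of_ae (hv (zeroIdx N m))] with x hx
    rw [hx]
    simp only [zeroIdx, classicalD_zero]
  have h3 : (volume.restrict Ω).real A = volume.real (A ∩ Ω) := by
    simp [Measure.real, Measure.restrict_apply hAm]
  simp only [hG]
  rw [h2, h3]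
  refine h1.trans (mul_le_mul_of_nonneg_left (pureEnergy_le_topEnergy hm hs hv) ?_)
  have := lowFreq_nonneg N m R
  have : 0 < R := one_pos.trans_le hR
  positivity

end Density

/-! ### Size of the low frequency part and choice of the radius. -/

section LowFrequency

variable {N m : ℕ} {R : ℝ}

theorem lowFreq_one (N m : ℕ) : lowFreq N m 1 = 0 := by simp [lowFreq]

theorem integrableOn_lowFreq (N m : ℕ) (R : ℝ) :
    IntegrableOn (fun y : ℝ => y ^ (N - 1) * (y ^ (2 * m))⁻¹) (Ico 1 R) := by
  refine (ContinuousOn.integrableOn_Icc (a := 1) (b := R) ?_).mono_set Ico_subset_Icc_self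
  refine (continuousOn_pow _).mul ((continuousOn_pow _).inv₀ fun y hy => ?_)
  have : 0 < y := one_pos.trans_le hy.1
  positivity

theorem lowFreq_of_lt (hN : 1 ≤ N) (h : 2 * m < N) (hR : 1 ≤ R) :
    lowFreq N m R ≤ R ^ (N - 2 * m) := by
  have h1 : lowFreq N m R ≤ ∫ _ in Ico 1 R, R ^ (N - 2 * m - 1) := by
    refine setIntegral_mono_on (integrableOn_lowFreq N m R) (by simp) measurableSet_Ico
      fun y hy => ?_
    have hy0 : 0 < y := one_pos.trans_le hy.1
    have h2 : N - 1 = (N - 2 * m - 1) + 2 * m := by omega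
    rw [h2, pow_add, mul_assoc, mul_inv_cancel₀ (by positivity), mul_one]
    exact pow_le_pow_left₀ hy0.le hy.2.le _
  refine h1.trans ?_
  have h2 : N - 2 * m = (N - 2 * m - 1) + 1 := by omega
  have h3 : 0 ≤ R ^ (N - 2 * m - 1) := by positivity
  rw [setIntegral_const, smul_eq_mul, Real.volume_real_Ico_of_le hR]
  nth_rw 2 [h2]
  rw [pow_succ]
  nlinarith

theorem lowFreq_of_gt (h : N < 2 * m) (hR : 1 ≤ R) : lowFreq N m R ≤ 1 := by
  have h0 : ContinuousOn (fun y : ℝ => (y ^ 2)⁻¹) (Icc 1 R) :=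
    (continuousOn_pow _).inv₀ fun y hy => by
      have : 0 < y := one_pos.trans_le hy.1
      positivity
  have h1 : lowFreq N m R ≤ ∫ y in Ico 1 R, (y ^ 2)⁻¹ := by
    refine setIntegral_mono_on (integrableOn_lowFreq N m R)
      (h0.integrableOn_Icc.mono_set Ico_subset_Icc_self) measurableSet_Ico fun y hy => ?_
    have hy0 : 0 < y := one_pos.trans_le hy.1
    rw [← div_eq_mul_inv, div_le_iff₀ (by positivity), inv_mul_eq_div, le_div_iff₀ (by positivity),
      ← pow_add]
    exact pow_le_pow_right₀ hy.1 (by omega)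
  refine h1.trans ?_
  have h2 : ∫ y in (1 : ℝ)..R, (y ^ 2)⁻¹ = 1 - R⁻¹ := by
    rw [intervalIntegral.integral_eq_sub_of_hasDerivAt (f := fun y => -y⁻¹)]
    · simp; ring
    · intro y hy
      rw [uIcc_of_le hR] at hy
      have hy0 : 0 < y := one_pos.trans_le hy.1
      simpa using (hasDerivAt_inv hy0.ne').fun_neg
    · exact (uIcc_of_le hR ▸ h0).intervalIntegrable
  rw [integral_Ico_eq_integral_Ioo, ← integral_Ioc_eq_integral_Ioo,
    ← intervalIntegral.integral_of_le hR, h2]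
  have : 0 < R⁻¹ := by positivity
  linarith

theorem lowFreq_of_eq (hN : 1 ≤ N) (h : N = 2 * m) (hR : 1 ≤ R) :
    lowFreq N m R = Real.log R := by
  have h1 : lowFreq N m R = ∫ y in Ico 1 R, y⁻¹ := by
    refine setIntegral_congr_fun measurableSet_Ico fun y hy => ?_
    have hy0 : 0 < y := one_pos.trans_le hy.1
    have h2 : 2 * m = (N - 1) + 1 := by omega
    rw [h2, pow_succ]
    field_simp
  rw [h1, integral_Ico_eq_integral_Ioo, ← integral_Ioc_eq_integral_Ioo,
    ← intervalIntegral.integral_of_le hR, integral_inv_of_pos one_pos (one_pos.trans_le hR)]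
  simp

/-- The radius balances the two terms. If N < 2m, the low frequency part is bounded and R^{-2m} = r.
If N > 2m, R = r^{-1/N} makes r R^{N-2m} and R^{-2m} both equal to r^{2m/N}, which also dominates r.
-/
theorem exists_radius_of_ne (hN : 1 ≤ N) (hm : 1 ≤ m) (h : N ≠ 2 * m) {r : ℝ} (hr0 : 0 < r)
    (hr1 : r < 1) :
    ∃ R : ℝ, 1 ≤ R ∧ r * (1 + lowFreq N m R) + (R ^ (2 * m))⁻¹ ≤
      3 * r ^ min (2 * (m : ℝ) / (N : ℝ)) 1 := by
  have hN0 : (0 : ℝ) < N := by exact_mod_cast hN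
  have hm0 : (0 : ℝ) < m := by exact_mod_cast hm
  rcases lt_or_gt_of_ne h with h | h
  · have hmin : min (2 * (m : ℝ) / (N : ℝ)) 1 = 1 := by
      refine min_eq_right ((one_le_div hN0).2 ?_)
      exact_mod_cast h.le
    have hR : 1 ≤ r ^ (-(1 / (2 * m : ℝ))) :=
      Real.one_le_rpow_of_pos_of_le_one_of_nonpos hr0 hr1.le (by
        have : 0 ≤ 1 / (2 * m : ℝ) := by positivity
        linarith)
    refine ⟨r ^ (-(1 / (2 * m : ℝ))), hR, ?_⟩
    have e1 : (r ^ (-(1 / (2 * m : ℝ)))) ^ (2 * m) = r⁻¹ := by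
      rw [← Real.rpow_natCast, ← Real.rpow_mul hr0.le, ← Real.rpow_neg_one]
      congr 1
      push_cast
      field_simp
    rw [e1, hmin, Real.rpow_one, inv_inv]
    have := lowFreq_of_gt h hR
    nlinarith
  · have hle : 2 * (m : ℝ) / (N : ℝ) ≤ 1 := by
      rw [div_le_one hN0]
      exact_mod_cast h.le
    have hmin : min (2 * (m : ℝ) / (N : ℝ)) 1 = 2 * (m : ℝ) / (N : ℝ) := min_eq_left hle
    have hR : 1 ≤ r ^ (-(1 / (N : ℝ))) :=
      Real.one_le_rpow_of_pos_of_le_one_of_nonpos hr0 hr1.le (by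
        have : 0 ≤ 1 / (N : ℝ) := by positivity
        linarith)
    refine ⟨r ^ (-(1 / (N : ℝ))), hR, ?_⟩
    have e1 : ((r ^ (-(1 / (N : ℝ)))) ^ (2 * m))⁻¹ = r ^ (2 * (m : ℝ) / N) := by
      rw [← Real.rpow_natCast, ← Real.rpow_mul hr0.le, ← Real.rpow_neg hr0.le]
      congr 1
      push_cast
      ring
    have e2 : r * (r ^ (-(1 / (N : ℝ)))) ^ (N - 2 * m) = r ^ (2 * (m : ℝ) / N) := by
      nth_rw 1 [← Real.rpow_one r]
      rw [← Real.rpow_natCast, ← Real.rpow_mul hr0.le, ← Real.rpow_add hr0]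
      congr 1
      rw [Nat.cast_sub h.le]
      push_cast
      field_simp
      ring
    rw [e1, hmin]
    have h1 := mul_le_mul_of_nonneg_left (lowFreq_of_lt hN h hR) hr0.le
    rw [e2] at h1
    have h2 : r ≤ r ^ (2 * (m : ℝ) / N) := by
      nth_rw 1 [← Real.rpow_one r]
      exact Real.rpow_le_rpow_of_exponent_ge hr0 hr1.le hle
    linarith

/-- With R = r^{-1/N} one has R^{-2m} = r, and the critical integral is log R = -(log r)/N ≤ -log r.
-/
theorem exists_radius_of_eq (hN : 1 ≤ N) (h : N = 2 * m) {r : ℝ} (hr0 : 0 < r)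
    (hr1 : r < 1) :
    ∃ R : ℝ, 1 ≤ R ∧ r * (1 + lowFreq N m R) + (R ^ (2 * m))⁻¹ ≤ r * (2 - Real.log r) := by
  have hN0 : (1 : ℝ) ≤ N := by exact_mod_cast hN
  have hR : 1 ≤ r ^ (-(1 / (N : ℝ))) :=
    Real.one_le_rpow_of_pos_of_le_one_of_nonpos hr0 hr1.le (by
      have : 0 ≤ 1 / (N : ℝ) := by positivity
      linarith)
  refine ⟨r ^ (-(1 / (N : ℝ))), hR, ?_⟩
  have e1 : ((r ^ (-(1 / (N : ℝ)))) ^ (2 * m))⁻¹ = r := by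
    rw [← h, ← Real.rpow_natCast, ← Real.rpow_mul hr0.le, ← Real.rpow_neg hr0.le]
    nth_rw 2 [← Real.rpow_one r]
    congr 1
    field_simp
  rw [e1, lowFreq_of_eq hN h hR, Real.log_rpow hr0]
  have h1 : -(1 / (N : ℝ)) * Real.log r ≤ - Real.log r := by
    have h2 := Real.log_neg hr0 hr1
    have h3 : 1 / (N : ℝ) ≤ 1 := by rw [div_le_one (by linarith)]; exact hN0
    nlinarith
  nlinarith

end LowFrequency

/-! ### The localized inequality with R optimized. -/

section Profiles

variable {N m : ℕ} {Ω : Set (Sp N)}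

/-- Only small sets need an optimized radius. For |A| ≥ 1 the choice R = 1, where the low frequency
integral vanishes, suffices since |A| ≤ |Ω|; null sets are trivial. -/
theorem exists_setIntegral_le_of_profile (hN : 1 ≤ N) (hm : 1 ≤ m) (hΩo : IsOpen Ω)
    (hΩb : Bornology.IsBounded Ω) {Φ : ℝ → ℝ} (h0 : Φ 0 = 0)
    (h : ∀ r : ℝ, 0 < r → r < 1 → ∃ R : ℝ, 1 ≤ R ∧
      r * (1 + lowFreq N m R) + (R ^ (2 * m))⁻¹ ≤ Φ r) (h1 : ∀ r : ℝ, 1 ≤ r → 1 ≤ Φ r) :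
    ∃ K : ℝ, 0 ≤ K ∧ ∀ (v : W0 Ω m) (A : Set (Sp N)),
      NullMeasurableSet A (volume.restrict Ω) →
      ∫ x in A, toL2 v x ^ 2 ∂volume.restrict Ω ≤
        K * Φ ((volume.restrict Ω).real A) * topEnergy v.1 := by
  have hfin : IsFiniteMeasure (volume.restrict Ω) := ⟨by simpa using hΩb.measure_lt_top⟩
  obtain ⟨K, hK0, hK⟩ := exists_setIntegral_le hN hm hΩo hΩb
  set V := (volume.restrict Ω).real univ with hV
  have hV0 : 0 ≤ V := measureReal_nonneg
  refine ⟨K * (V + 1), by positivity, fun v A hA => ?_⟩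
  have hT := topEnergy_nonneg v.1
  set r := (volume.restrict Ω).real A with hr
  rcases (measureReal_nonneg (μ := volume.restrict Ω) (s := A)).eq_or_lt with hz | hpos
  · have : (volume.restrict Ω) A = 0 := by
      rw [← measureReal_eq_zero_iff]; exact hz.symm
    rw [Measure.restrict_eq_zero.2 this, hr, ← hz, h0]
    simp
  rcases lt_or_ge r 1 with hlt | hge
  · obtain ⟨R, hR, hle⟩ := h r hpos hlt
    refine (hK v A hA R hR).trans (mul_le_mul_of_nonneg_right ?_ hT)
    have hΦ : 0 ≤ Φ r := by
      refine le_trans ?_ hle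
      have := lowFreq_nonneg N m R
      positivity
    rw [mul_assoc]
    refine mul_le_mul_of_nonneg_left ?_ hK0
    refine hle.trans (le_mul_of_one_le_left hΦ (by linarith))
  · refine (hK v A hA 1 le_rfl).trans (mul_le_mul_of_nonneg_right ?_ hT)
    rw [lowFreq_one, ← hr, mul_assoc]
    refine mul_le_mul_of_nonneg_left ?_ hK0
    have h2 : r ≤ V := measureReal_mono (subset_univ _)
    have h3 := h1 r hge
    simp only [add_zero, mul_one, one_pow, inv_one]
    nlinarith

theorem exists_setIntegral_le_rpow_of_ne (hN : 1 ≤ N) (hm : 1 ≤ m) (hΩo : IsOpen Ω)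
    (hΩb : Bornology.IsBounded Ω) (h : N ≠ 2 * m) :
    ∃ K : ℝ, 0 ≤ K ∧ ∀ (v : W0 Ω m) (A : Set (Sp N)),
      NullMeasurableSet A (volume.restrict Ω) →
      ∫ x in A, toL2 v x ^ 2 ∂volume.restrict Ω ≤
        K * (volume.restrict Ω).real A ^ min (2 * (m : ℝ) / (N : ℝ)) 1 * topEnergy v.1 := by
  have hN0 : (0 : ℝ) < N := by exact_mod_cast hN
  have hm0 : (0 : ℝ) < m := by exact_mod_cast hm
  have hθ : 0 < min (2 * (m : ℝ) / (N : ℝ)) 1 := lt_min (by positivity) one_pos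
  obtain ⟨K, hK0, hK⟩ := exists_setIntegral_le_of_profile hN hm hΩo hΩb
    (Φ := fun r => 3 * r ^ min (2 * (m : ℝ) / (N : ℝ)) 1)
    (by simp [Real.zero_rpow hθ.ne']) (fun r h0 h1 => exists_radius_of_ne hN hm h h0 h1)
    (fun r hr => by
      have := Real.one_le_rpow hr hθ.le
      linarith)
  refine ⟨K * 3, by positivity, fun v A hA => (hK v A hA).trans_eq (by ring)⟩

theorem exists_setIntegral_le_log_of_eq (hN : 1 ≤ N) (hm : 1 ≤ m) (hΩo : IsOpen Ω)
    (hΩb : Bornology.IsBounded Ω) (h : N = 2 * m) :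
    ∃ K : ℝ, 0 ≤ K ∧ ∀ (v : W0 Ω m) (A : Set (Sp N)),
      NullMeasurableSet A (volume.restrict Ω) → (volume.restrict Ω).real A < 1 →
      ∫ x in A, toL2 v x ^ 2 ∂volume.restrict Ω ≤
        K * ((volume.restrict Ω).real A * (2 - Real.log ((volume.restrict Ω).real A))) *
          topEnergy v.1 := by
  obtain ⟨K, hK0, hK⟩ := exists_setIntegral_le_of_profile hN hm hΩo hΩb
    -- The logarithmic profile is not bounded below by 1 for large r, hence the cut at r = 1.
    (Φ := fun r => if r < 1 then r * (2 - Real.log r) else 1)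
    (by simp) (fun r h0 h1 => by simpa [h1] using exists_radius_of_eq hN h h0 h1)
    (fun r hr => by simp [not_lt.2 hr])
  refine ⟨K, hK0, fun v A hA hr => ?_⟩
  simpa [hr] using hK v A hA

theorem mul_two_sub_log_le {r : ℝ} (hr : 0 < r) (h1 : r < 1) :
    r * (2 - Real.log r) ≤ 4 * r ^ (1 / 2 : ℝ) := by
  have h2 : -Real.log r ≤ 2 * r ^ (-(1 / 2) : ℝ) := by
    have := Real.log_le_rpow_div (x := r⁻¹) (by positivity) (ε := 1 / 2) (by norm_num)
    rw [Real.log_inv, Real.inv_rpow hr.le, ← Real.rpow_neg hr.le] at this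
    linarith
  have h3 : r * r ^ (-(1 / 2) : ℝ) = r ^ (1 / 2 : ℝ) := by
    nth_rw 1 [← Real.rpow_one r]
    rw [← Real.rpow_add hr]
    norm_num
  have h4 : r ≤ r ^ (1 / 2 : ℝ) := by
    nth_rw 1 [← Real.rpow_one r]
    exact Real.rpow_le_rpow_of_exponent_ge hr h1.le (by norm_num)
  nlinarith

/-- A set of small measure carries a small part of the `L²` norm of a function of bounded
energy. -/
theorem exists_setIntegral_le_rpow (hN : 1 ≤ N) (hm : 1 ≤ m) (hΩo : IsOpen Ω)
    (hΩb : Bornology.IsBounded Ω) :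
    ∃ K σ : ℝ, 0 ≤ K ∧ 0 < σ ∧ ∀ (v : W0 Ω m) (A : Set (Sp N)),
      NullMeasurableSet A (volume.restrict Ω) →
      ∫ x in A, toL2 v x ^ 2 ∂volume.restrict Ω ≤
        K * (volume.restrict Ω).real A ^ σ * topEnergy v.1 := by
  rcases ne_or_eq N (2 * m) with h | h
  · obtain ⟨K, hK0, hK⟩ := exists_setIntegral_le_rpow_of_ne hN hm hΩo hΩb h
    have hN0 : (0 : ℝ) < N := by exact_mod_cast hN
    have hm0 : (0 : ℝ) < m := by exact_mod_cast hm
    exact ⟨K, _, hK0, lt_min (by positivity) one_pos, hK⟩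
  · obtain ⟨K, hK0, hK⟩ := exists_setIntegral_le_of_profile hN hm hΩo hΩb
      (Φ := fun r => 4 * r ^ (1 / 2 : ℝ)) (by simp)
      (fun r h0 h1 => by
        obtain ⟨R, hR, hle⟩ := exists_radius_of_eq hN h h0 h1
        exact ⟨R, hR, hle.trans (mul_two_sub_log_le h0 h1)⟩)
      (fun r hr => by
        have := Real.one_le_rpow hr (z := 1 / 2) (by norm_num)
        linarith)
    exact ⟨K * 4, 1 / 2, by positivity, by norm_num,
      fun v A hA => (hK v A hA).trans_eq (by ring)⟩

end Profiles

/-! ### Control of the mass by the energy at a given scale. -/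

section Dissipation

variable {N m : ℕ} {Ω : Set (Sp N)} {a : Sp N → ℝ} {q : ℝ}

theorem integrable_rpow_abs {α : Type*} [MeasurableSpace α] {μ : Measure α} [IsFiniteMeasure μ]
    {p : ℝ} (hp0 : 0 < p) (hp2 : p ≤ 2) (f : Lp ℝ 2 μ) : Integrable (fun x => |f x| ^ p) μ := by
  have h2 := (Lp.memLp f).integrable_sq
  refine (h2.add (integrable_const 1)).mono'
    ((Lp.aestronglyMeasurable f).norm.aemeasurable.pow_const p).aestronglyMeasurable
    (Filter.Eventually.of_forall fun x => ?_)
  have h0 := abs_nonneg (f x)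
  rw [Real.norm_of_nonneg (by positivity), Pi.add_apply, ← sq_abs]
  rcases le_total |f x| 1 with h | h
  · have := Real.rpow_le_one h0 h hp0.le
    nlinarith [sq_nonneg |f x|]
  · have := Real.rpow_le_rpow_of_exponent_le h hp2
    rw [Real.rpow_two] at this
    linarith

theorem integrable_absorption (hΩo : IsOpen Ω) (hΩb : Bornology.IsBounded Ω)
    (ham : AEMeasurable a (volume.restrict Ω)) (ha0 : ∀ x ∈ Ω, 0 ≤ a x)
    (hab : ∃ K : ℝ, ∀ x ∈ Ω, a x ≤ K) (hq0 : 0 < q) (hq1 : q < 1) (f : L2 Ω) :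
    Integrable (fun x => a x * |f x| ^ (q + 1)) (volume.restrict Ω) := by
  have hfin : IsFiniteMeasure (volume.restrict Ω) := ⟨by simpa using hΩb.measure_lt_top⟩
  obtain ⟨K, hK⟩ := hab
  refine (integrable_rpow_abs (by linarith) (by linarith) f).bdd_mul
    (c := K) ham.aestronglyMeasurable ?_
  filter_upwards [ae_restrict_mem hΩo.measurableSet] with x hx
  rw [Real.norm_of_nonneg (ha0 x hx)]
  exact hK x hx

/-- The mass of a function in terms of its energy: the part on `{a ≤ s}` is left as it stands, the
rest is split according to whether the function exceeds `τ`. -/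
theorem norm_sq_le_of_energy (hΩo : IsOpen Ω) (hΩb : Bornology.IsBounded Ω)
    (ham : AEMeasurable a (volume.restrict Ω)) (ha0 : ∀ x ∈ Ω, 0 ≤ a x)
    (hab : ∃ K : ℝ, ∀ x ∈ Ω, a x ≤ K) (hq0 : 0 < q) (hq1 : q < 1) {K σ L E : ℝ} (hK0 : 0 ≤ K)
    (hσ : 0 < σ)
    (hK : ∀ (v : W0 Ω m) (A : Set (Sp N)), NullMeasurableSet A (volume.restrict Ω) →
      ∫ x in A, toL2 v x ^ 2 ∂volume.restrict Ω ≤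
        K * (volume.restrict Ω).real A ^ σ * topEnergy v.1)
    (v : W0 Ω m) (hE1 : topEnergy v.1 ≤ L * E)
    (hE2 : ∫ x in Ω, a x * |toL2 v x| ^ (q + 1) ≤ E)
    {s τ : ℝ} (hs : 0 < s) (hτ : 0 < τ) :
    ‖toL2 v‖ ^ 2 ≤ (∫ x in {x | a x ≤ s}, toL2 v x ^ 2 ∂volume.restrict Ω) +
      K * ((τ ^ (q + 1) * s)⁻¹ * E) ^ σ * (L * E) + τ ^ (1 - q) / s * E := by
  have hfin : IsFiniteMeasure (volume.restrict Ω) := ⟨by simpa using hΩb.measure_lt_top⟩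
  set μ := volume.restrict Ω with hμ
  set f := toL2 v with hf
  have hsq := (Lp.memLp f).integrable_sq
  have hP := integrable_absorption hΩo hΩb ham ha0 hab hq0 hq1 f
  have haμ : ∀ᵐ x ∂μ, 0 ≤ a x := by
    filter_upwards [ae_restrict_mem hΩo.measurableSet] with x hx using ha0 x hx
  have hP0 : 0 ≤ᵐ[μ] fun x => a x * |f x| ^ (q + 1) := by
    filter_upwards [haμ] with x hx
    simp only [Pi.zero_apply]
    positivity
  have hE0 : 0 ≤ E := (integral_nonneg_of_ae hP0).trans hE2
  have hfm : AEMeasurable f μ := (Lp.aestronglyMeasurable f).aemeasurable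
  have hA1 : NullMeasurableSet {x | a x ≤ s} μ := nullMeasurableSet_le ham aemeasurable_const
  have hA2 : NullMeasurableSet {x | s < a x ∧ τ < |f x|} μ :=
    (nullMeasurableSet_lt aemeasurable_const ham).inter
      (nullMeasurableSet_lt aemeasurable_const hfm.norm)
  set A1 := {x | a x ≤ s} with hA1d
  set A2 := {x | s < a x ∧ τ < |f x|} with hA2d
  have hτs : 0 < τ ^ (q + 1) * s := by positivity
  -- Chebyshev: on A2 the absorption density exceeds τ^{q+1} s.
  have hmark : μ.real A2 ≤ (τ ^ (q + 1) * s)⁻¹ * E := by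
    have h1 := mul_meas_ge_le_integral_of_nonneg hP0 hP (τ ^ (q + 1) * s)
    have h2 : μ.real A2 ≤ μ.real {x | τ ^ (q + 1) * s ≤ a x * |f x| ^ (q + 1)} := by
      refine measureReal_mono fun x hx => ?_
      have h3 : τ ^ (q + 1) ≤ |f x| ^ (q + 1) :=
        Real.rpow_le_rpow hτ.le hx.2.le (by linarith)
      have h4 : 0 ≤ τ ^ (q + 1) := by positivity
      simp only [mem_ofPred_eq]
      nlinarith [hx.1]
    rw [inv_mul_eq_div, le_div_iff₀ hτs]
    nlinarith
  have hpt : ∀ᵐ x ∂μ, f x ^ 2 ≤ A1.indicator (fun x => f x ^ 2) x +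
      A2.indicator (fun x => f x ^ 2) x + τ ^ (1 - q) / s * (a x * |f x| ^ (q + 1)) := by
    filter_upwards [haμ] with x hx
    have h0 : 0 ≤ τ ^ (1 - q) / s * (a x * |f x| ^ (q + 1)) := by positivity
    by_cases h1 : x ∈ A1
    · have h2 : x ∉ A2 := fun h => absurd h.1 (not_lt.2 h1)
      simp only [h1, h2, indicator_of_mem, indicator_of_notMem, not_false_eq_true]
      linarith
    by_cases h2 : x ∈ A2
    · simp only [h1, h2, indicator_of_mem, indicator_of_notMem, not_false_eq_true]
      linarith
    have h3 : s < a x := not_le.1 h1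
    have h4 : |f x| ≤ τ := not_lt.1 fun h => h2 ⟨h3, h⟩
    simp only [h1, h2, indicator_of_notMem, not_false_eq_true, zero_add]
    -- Here |f| ≤ τ and a > s. As q < 1, the surplus power |f|^{1-q} is bounded by τ^{1-q}, and the
    -- missing factor a is supplied by a/s ≥ 1.
    have h5 : f x ^ 2 = |f x| ^ (1 - q) * |f x| ^ (q + 1) := by
      have h51 : (1 - q) + (q + 1) = 2 := by ring
      rw [← Real.rpow_add' (abs_nonneg _) (by rw [h51]; norm_num), h51, Real.rpow_two, sq_abs]
    rw [h5]
    have h6 : |f x| ^ (1 - q) ≤ τ ^ (1 - q) :=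
      Real.rpow_le_rpow (abs_nonneg _) h4 (by linarith)
    have h7 : 1 ≤ a x / s := (one_le_div hs).2 h3.le
    have h8 : 0 ≤ τ ^ (1 - q) * |f x| ^ (q + 1) := by positivity
    calc |f x| ^ (1 - q) * |f x| ^ (q + 1) ≤ τ ^ (1 - q) * |f x| ^ (q + 1) :=
          mul_le_mul_of_nonneg_right h6 (by positivity)
      _ ≤ τ ^ (1 - q) * |f x| ^ (q + 1) * (a x / s) := le_mul_of_one_le_right h8 h7
      _ = _ := by ring
  have i1 : Integrable (A1.indicator fun x => f x ^ 2) μ := hsq.indicator₀ hA1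
  have i2 : Integrable (A2.indicator fun x => f x ^ 2) μ := hsq.indicator₀ hA2
  rw [norm_sq_eq_integral]
  refine (integral_mono_ae hsq ((i1.add i2).add (hP.const_mul _)) hpt).trans ?_
  have h12 : ∫ x, A1.indicator (fun x => f x ^ 2) x + A2.indicator (fun x => f x ^ 2) x +
      τ ^ (1 - q) / s * (a x * |f x| ^ (q + 1)) ∂μ = (∫ x in A1, f x ^ 2 ∂μ) +
      (∫ x in A2, f x ^ 2 ∂μ) + τ ^ (1 - q) / s * ∫ x, a x * |f x| ^ (q + 1) ∂μ := by
    refine (integral_add (i1.add i2) (hP.const_mul _)).trans ?_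
    rw [integral_const_mul, integral_add' i1 i2, integral_indicator₀ hA1, integral_indicator₀ hA2]
  refine h12.trans_le ?_
  have h2 : ∫ x in A2, f x ^ 2 ∂μ ≤ K * ((τ ^ (q + 1) * s)⁻¹ * E) ^ σ * (L * E) := by
    refine (hK v A2 hA2).trans ?_
    have h3 : μ.real A2 ^ σ ≤ ((τ ^ (q + 1) * s)⁻¹ * E) ^ σ :=
      Real.rpow_le_rpow measureReal_nonneg hmark hσ.le
    exact mul_le_mul (mul_le_mul_of_nonneg_left h3 hK0) hE1 (topEnergy_nonneg _)
      (by positivity)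
  have h3 : τ ^ (1 - q) / s * ∫ x, a x * |f x| ^ (q + 1) ∂μ ≤ τ ^ (1 - q) / s * E :=
    mul_le_mul_of_nonneg_left hE2 (by positivity)
  linarith

/-- The estimate of `norm_sq_le_of_energy` for energies at most `ε`, with the choices
`s = ε^δ` and `τ = ε^{1/2}`, `δ = (1 - q)/4`. -/
theorem norm_sq_le_mul_energy (hΩo : IsOpen Ω) (hΩb : Bornology.IsBounded Ω)
    (ham : AEMeasurable a (volume.restrict Ω)) (ha0 : ∀ x ∈ Ω, 0 ≤ a x)
    (hab : ∃ K : ℝ, ∀ x ∈ Ω, a x ≤ K) (hq0 : 0 < q) (hq1 : q < 1) {K σ L E : ℝ} (hK0 : 0 ≤ K)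
    (hσ : 0 < σ) (hL : 0 ≤ L)
    (hK : ∀ (v : W0 Ω m) (A : Set (Sp N)), NullMeasurableSet A (volume.restrict Ω) →
      ∫ x in A, toL2 v x ^ 2 ∂volume.restrict Ω ≤
        K * (volume.restrict Ω).real A ^ σ * topEnergy v.1)
    (v : W0 Ω m) (hE1 : topEnergy v.1 ≤ L * E)
    (hE2 : ∫ x in Ω, a x * |toL2 v x| ^ (q + 1) ≤ E)
    {ε Φ : ℝ} (hε : 0 < ε) (hEε : E ≤ ε)
    (hΦ : ∫ x in {x | a x ≤ ε ^ ((1 - q) / 4)}, toL2 v x ^ 2 ∂volume.restrict Ω ≤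
      Φ * topEnergy v.1) (hΦ0 : 0 ≤ Φ) :
    ‖toL2 v‖ ^ 2 ≤
      E * (L * Φ + K * L * (ε ^ ((1 - q) / 4)) ^ σ + ε ^ ((1 - q) / 4)) := by
  have h := norm_sq_le_of_energy hΩo hΩb ham ha0 hab hq0 hq1 hK0 hσ hK v hE1 hE2
    (s := ε ^ ((1 - q) / 4)) (τ := ε ^ (1 / 2 : ℝ)) (by positivity) (by positivity)
  have hE0 : 0 ≤ E := by
    refine le_trans (integral_nonneg_of_ae ?_) hE2
    filter_upwards [ae_restrict_mem hΩo.measurableSet] with x hx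
    have := ha0 x hx
    simp only [Pi.zero_apply]
    positivity
  -- The choice δ = (1 - q)/4 equalizes the exponents: 1 - (q + 1)/2 - δ = δ for the measure of the
  -- exceptional set, and (1 - q)/2 - δ = δ for the factor τ^{1-q}/s.
  have e1 : ((ε ^ (1 / 2 : ℝ)) ^ (q + 1) * ε ^ ((1 - q) / 4))⁻¹ * E ≤ ε ^ ((1 - q) / 4) := by
    refine (mul_le_mul_of_nonneg_left hEε (by positivity)).trans_eq ?_
    rw [← Real.rpow_mul hε.le, ← Real.rpow_add hε, ← Real.rpow_neg hε.le]
    nth_rw 2 [← Real.rpow_one ε]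
    rw [← Real.rpow_add hε]
    congr 1
    ring
  have e2 : (ε ^ (1 / 2 : ℝ)) ^ (1 - q) / ε ^ ((1 - q) / 4) = ε ^ ((1 - q) / 4) := by
    rw [← Real.rpow_mul hε.le, ← Real.rpow_sub hε]
    congr 1
    ring
  rw [e2] at h
  have e3 : (((ε ^ (1 / 2 : ℝ)) ^ (q + 1) * ε ^ ((1 - q) / 4))⁻¹ * E) ^ σ ≤
      (ε ^ ((1 - q) / 4)) ^ σ := Real.rpow_le_rpow (by positivity) e1 hσ.le
  have e4 := mul_le_mul_of_nonneg_right (mul_le_mul_of_nonneg_left e3 hK0) (mul_nonneg hL hE0)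
  have e5 := mul_le_mul_of_nonneg_left hE1 hΦ0
  nlinarith

end Dissipation

/-! ### Finite time extinction from dissipation, and summability of profiles. -/

section Decay

/-- A nonincreasing function dissipating at rate `2e`, where on each dyadic scale the dissipation
`e` is either large or controls the function with a summable constant, vanishes in finite time. -/
theorem exists_eq_zero_of_dissipation {y e : ℝ → ℝ} (hy0 : ∀ t, 0 < t → 0 ≤ y t)
    (he0 : ∀ᵐ t ∂volume.restrict (Ioi (0 : ℝ)), 0 ≤ e t)
    (hei : ∀ s t, 0 < s → s ≤ t → IntegrableOn e (Ioc s t))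
    (hye : ∀ s t, 0 < s → s ≤ t → y s - y t = 2 * ∫ r in Ioc s t, e r)
    {P : ℝ} (hP : ∀ᵐ t ∂volume.restrict (Ioi (0 : ℝ)), y t ≤ P * e t)
    {g : ℕ → ℝ} (hg0 : ∀ k, 0 ≤ g k) (hg : Summable g) {k₀ : ℕ}
    (h : ∀ k, k₀ ≤ k → ∀ᵐ t ∂volume.restrict (Ioi (0 : ℝ)), e t ≤ (1 / 2) ^ k →
      y t ≤ e t * g k) :
    ∃ T : ℝ, 0 < T ∧ ∀ t, T ≤ t → y t = 0 := by
  have hanti : ∀ s t, 0 < s → s ≤ t → y t ≤ y s := by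
    intro s t hs hst
    have h1 := hye s t hs hst
    have h2 : 0 ≤ ∫ r in Ioc s t, e r :=
      integral_nonneg_of_ae (ae_restrict_of_ae_restrict_of_subset
        (fun r hr => hs.trans hr.1) he0)
    linarith
  -- lower bound for the decrease of `y`
  have hdec : ∀ s t c, 0 < s → s ≤ t →
      (∀ᵐ r ∂volume.restrict (Ioi (0 : ℝ)), r ∈ Ioc s t → c ≤ e r) →
      2 * (c * (t - s)) ≤ y s - y t := by
    intro s t c hs hst hc
    rw [hye s t hs hst]
    have h1 : ∫ _ in Ioc s t, c ≤ ∫ r in Ioc s t, e r := by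
      refine setIntegral_mono_on_ae (by simp) (hei s t hs hst) measurableSet_Ioc ?_
      rw [ae_restrict_iff' measurableSet_Ioi] at hc
      filter_upwards [hc] with r hr hr2 using hr (hs.trans hr2.1) hr2
    rw [setIntegral_const, Real.volume_real_Ioc_of_le hst, smul_eq_mul] at h1
    linarith
  -- `y` tends to zero
  obtain ⟨t₀, ht₀, hyt₀⟩ : ∃ t₀ : ℝ, 0 < t₀ ∧ y t₀ ≤ (1 / 4) ^ k₀ := by
    by_contra! hcon
    set d : ℝ := (1 / 4) ^ k₀ with hd
    have hd0 : 0 < d := by positivity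
    have hy1 := hcon 1 one_pos
    have hP0 : 0 < |P| + 1 := by positivity
    have hpos : 0 ≤ (|P| + 1) * y 1 / d := by
      have := hy0 1 one_pos
      positivity
    -- If y stayed above d, then e ≥ d/(|P| + 1) a.e. on this interval, whose length forces a
    -- decrease of 2 y(1), more than is available.
    have := hdec 1 (1 + (|P| + 1) * y 1 / d) (d / (|P| + 1)) one_pos (by linarith) (by
      filter_upwards [hP, he0, ae_restrict_mem measurableSet_Ioi] with r h1 h2 h3 h4
      rw [div_le_iff₀ hP0]
      have h5 := hcon r h3
      have h6 := le_abs_self P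
      nlinarith)
    have e1 : d / (|P| + 1) * (1 + (|P| + 1) * y 1 / d - 1) = y 1 := by field_simp; ring
    rw [e1] at this
    have h7 := hy0 (1 + (|P| + 1) * y 1 / d) (by linarith)
    linarith
  -- While y > 4^{-k-1}, e D_k ≥ 4^{-k-1} in both cases: if e > 2^{-k} by the first term, since
  -- 4^{-k-1} = 2^{-k} · 2^{-k}/4, and otherwise by y ≤ e g_k.
  set D : ℕ → ℝ := fun k => (1 / 2) ^ k / 4 + g k with hD
  have hDpos : ∀ k, 0 < D k := fun k => by
    have := hg0 k
    simp only [hD]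
    positivity
  have hstep : ∀ k, k₀ ≤ k → ∀ s, 0 < s → y s ≤ (1 / 4) ^ k →
      y (s + 2 * D k) ≤ (1 / 4) ^ (k + 1) := by
    intro k hk s hs hys
    by_contra! hcon
    have hDk := hDpos k
    have hst : s ≤ s + 2 * D k := by linarith
    have hlow := hdec s (s + 2 * D k) ((1 / 4) ^ (k + 1) / D k) hs hst (by
      filter_upwards [h k hk, he0] with r h1 h2 h3
      rw [div_le_iff₀ hDk]
      have h4 : (1 / 4 : ℝ) ^ (k + 1) < y r :=
        hcon.trans_le (hanti r _ (hs.trans h3.1) h3.2)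
      have hpow : (1 / 2 : ℝ) ^ k * (1 / 2) ^ k = (1 / 4) ^ k := by
        rw [← mul_pow]; norm_num
      have hp2 : (0 : ℝ) < (1 / 2) ^ k := by positivity
      simp only [hD]
      rcases le_or_gt (e r) ((1 / 2) ^ k) with h5 | h5
      · have h6 := h1 h5
        nlinarith
      · have h6 : (1 / 4 : ℝ) ^ (k + 1) = (1 / 4) ^ k / 4 := by ring
        rw [h6, ← hpow]
        nlinarith [mul_nonneg h2 (hg0 k)])
    -- Dissipation being twice e, the decrease over a time 2 D_k would be at least 4 · 4^{-k-1} =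
    -- 4^{-k} ≥ y(s), leaving nothing.
    have e1 : (1 / 4 : ℝ) ^ (k + 1) / D k * (s + 2 * D k - s) = 2 * (1 / 4) ^ (k + 1) := by
      field_simp
      ring
    rw [e1] at hlow
    have h7 : (0 : ℝ) < (1 / 4) ^ (k + 1) := by positivity
    have h6 : (1 / 4 : ℝ) ^ (k + 1) = (1 / 4) ^ k / 4 := by ring
    linarith
  have hDsum : Summable D := by
    refine Summable.add ?_ hg
    exact (summable_geometric_of_lt_one (by norm_num) (by norm_num)).div_const 4
  set τ : ℕ → ℝ := fun n => t₀ + ∑ j ∈ Finset.range n, 2 * D (k₀ + j) with hτ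
  have hτpos : ∀ n, 0 < τ n := fun n => by
    have : 0 ≤ ∑ j ∈ Finset.range n, 2 * D (k₀ + j) :=
      Finset.sum_nonneg fun j _ => by linarith [hDpos (k₀ + j)]
    simp only [hτ]
    linarith
  have hyτ : ∀ n, y (τ n) ≤ (1 / 4) ^ (k₀ + n) := by
    intro n
    induction n with
    | zero => simpa [hτ] using hyt₀
    | succ n ih =>
      have h1 := hstep (k₀ + n) (Nat.le_add_right _ _) (τ n) (hτpos n) ih
      have h2 : τ (n + 1) = τ n + 2 * D (k₀ + n) := by
        simp only [hτ, Finset.sum_range_succ]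
        ring
      rw [h2]
      exact h1
  have hsum : Summable fun j => 2 * D (k₀ + j) := by
    have := (summable_nat_add_iff k₀).2 hDsum
    simpa only [add_comm] using this.mul_left 2
  have hτle : ∀ n, τ n ≤ t₀ + ∑' j, 2 * D (k₀ + j) := fun n => by
    have := hsum.sum_le_tsum (Finset.range n) (fun j _ => by linarith [hDpos (k₀ + j)])
    simp only [hτ]
    linarith
  refine ⟨t₀ + ∑' j, 2 * D (k₀ + j), (hτpos 0).trans_le (hτle 0), fun t ht => ?_⟩
  have htpos : 0 < t := (hτpos 0).trans_le ((hτle 0).trans ht)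
  refine le_antisymm ?_ (hy0 t htpos)
  have hlim : Filter.Tendsto (fun n : ℕ => (1 / 4 : ℝ) ^ (k₀ + n)) Filter.atTop (nhds 0) := by
    have := (tendsto_pow_atTop_nhds_zero_of_lt_one (r := (1 / 4 : ℝ)) (by norm_num)
      (by norm_num)).const_mul ((1 / 4 : ℝ) ^ k₀)
    simpa only [pow_add, mul_zero] using this
  exact ge_of_tendsto' hlim fun n =>
    (hanti (τ n) t (hτpos n) ((hτle n).trans ht)).trans (hyτ n)

/-- A monotone profile that is integrable against `ds/s` is summable along geometric sequences. -/
theorem summable_of_integrableOn_inv_mul {H : ℝ → ℝ} {ρ s₁ : ℝ} (hρ0 : 0 < ρ) (hρ1 : ρ < 1)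
    (hs₁ : 0 < s₁) (hH0 : ∀ s, 0 < s → s ≤ s₁ → 0 ≤ H s)
    (hmono : ∀ s t, 0 < s → s ≤ t → t ≤ s₁ → H s ≤ H t)
    (hint : IntegrableOn (fun s => s⁻¹ * H s) (Ioo 0 1)) :
    Summable fun k : ℕ => H (ρ ^ k) := by
  obtain ⟨n, hn⟩ := exists_pow_lt_of_lt_one (lt_min hs₁ one_pos) hρ1
  have hanti : Antitone fun k : ℕ => ρ ^ (n + k) := fun i j hij =>
    pow_le_pow_of_le_one hρ0.le hρ1.le (by omega)
  have hle : ∀ k : ℕ, ρ ^ (n + k) < min s₁ 1 := fun k => by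
    have : ρ ^ (n + k) ≤ ρ ^ (n + 0) := hanti (Nat.zero_le k)
    exact lt_of_le_of_lt (by simpa using this) hn
  have hdisj : Pairwise (Function.onFun Disjoint
      fun k : ℕ => Ioc (ρ ^ (n + (k + 1))) (ρ ^ (n + k))) := by
    simpa using hanti.pairwise_disjoint_on_Ioc_succ
  have hsub : (⋃ k : ℕ, Ioc (ρ ^ (n + (k + 1))) (ρ ^ (n + k))) ⊆ Ioo 0 1 := by
    refine iUnion_subset fun k x hx => ⟨lt_trans (by positivity) hx.1, ?_⟩
    exact hx.2.trans_lt ((hle k).trans_le (min_le_right _ _))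
  have hI := hint.mono_set hsub
  have hsum := (hasSum_integral_iUnion (fun k => measurableSet_Ioc) hdisj hI).summable
  -- On (ρ^{n+k+1}, ρ^{n+k}] the integrand is at least ρ^{-(n+k)} H(ρ^{n+k+1}), so its integral is
  -- at least (1 - ρ) H(ρ^{n+k+1}). The value sits at the left endpoint, hence the shift by n + 1
  -- instead of n.
  rw [← summable_nat_add_iff (n + 1)]
  refine Summable.of_nonneg_of_le (fun k => hH0 _ (by positivity) ?_) (fun k => ?_)
    (hsum.mul_left (1 - ρ)⁻¹)
  · have := hle (k + 1)
    rw [show k + (n + 1) = n + (k + 1) by ring]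
    exact this.le.trans (min_le_left _ _)
  · rw [show k + (n + 1) = n + (k + 1) by ring, inv_mul_eq_div, le_div_iff₀ (by linarith)]
    set c := ρ ^ (n + k) with hc
    have hc0 : 0 < c := by positivity
    have hc' : ρ ^ (n + (k + 1)) = ρ * c := by rw [hc]; ring
    have hcs : c ≤ s₁ := (hle k).le.trans (min_le_left _ _)
    rw [hc']
    have hlec : ρ * c ≤ c := by nlinarith
    have hHc : 0 ≤ H (ρ * c) := hH0 _ (by positivity) (hlec.trans hcs)
    have h1 : ∫ _ in Ioc (ρ * c) c, c⁻¹ * H (ρ * c) ≤ ∫ s in Ioc (ρ * c) c, s⁻¹ * H s := by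
      refine setIntegral_mono_on (integrableOn_const measure_Ioc_lt_top.ne) ?_ measurableSet_Ioc fun s hs => ?_
      · refine hint.mono_set fun x hx => ⟨lt_trans (by positivity) hx.1, ?_⟩
        exact hx.2.trans_lt ((hle k).trans_le (min_le_right _ _))
      · have hs0 : 0 < s := lt_trans (by positivity) hs.1
        refine mul_le_mul (inv_anti₀ hs0 hs.2)
          (hmono _ _ (by positivity) hs.1.le (hs.2.trans hcs)) hHc (by positivity)
    refine le_trans (le_of_eq ?_) h1
    rw [setIntegral_const, Real.volume_real_Ioc_of_le hlec, smul_eq_mul]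
    field_simp

end Decay

end Extinction

namespace Extinction

open Filter Topology

/-! ### From the distributional time derivative to an integral formula. -/

section WeakDerivative

/-- A smooth approximation of the Heaviside function at `a`, of width `1/n`. -/
def smoothStep (n : ℝ) (a t : ℝ) : ℝ := Real.smoothTransition (n * (t - a))

theorem contDiff_smoothStep (n a : ℝ) : ContDiff ℝ ∞ (smoothStep n a) := by
  have h : ContDiff ℝ ∞ Real.smoothTransition := Real.smoothTransition.contDiff (n := ⊤)
  exact h.comp (by fun_prop)

theorem smoothStep_of_le {n a t : ℝ} (hn : 0 ≤ n) (h : t ≤ a) : smoothStep n a t = 0 :=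
  Real.smoothTransition.zero_of_nonpos (mul_nonpos_of_nonneg_of_nonpos hn (by linarith))

theorem smoothStep_of_ge {n a t : ℝ} (hn : 0 < n) (h : a + 1 / n ≤ t) : smoothStep n a t = 1 := by
  refine Real.smoothTransition.one_of_one_le ?_
  have h1 : 1 / n ≤ t - a := by linarith
  rw [div_le_iff₀ hn] at h1
  linarith

theorem smoothStep_nonneg (n a t : ℝ) : 0 ≤ smoothStep n a t := Real.smoothTransition.nonneg _

theorem smoothStep_le_one (n a t : ℝ) : smoothStep n a t ≤ 1 := Real.smoothTransition.le_one _

theorem deriv_smoothStep_nonneg {n : ℝ} (hn : 0 ≤ n) (a t : ℝ) : 0 ≤ deriv (smoothStep n a) t := by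
  refine Monotone.deriv_nonneg fun x y hxy => ?_
  exact Real.smoothTransition.monotone (mul_le_mul_of_nonneg_left (by linarith) hn)

theorem deriv_smoothStep_of_lt {n a t : ℝ} (hn : 0 ≤ n) (h : t < a) :
    deriv (smoothStep n a) t = 0 := by
  have h1 : smoothStep n a =ᶠ[𝓝 t] fun _ => 0 := by
    filter_upwards [Iio_mem_nhds h] with x hx using smoothStep_of_le hn (le_of_lt hx)
  rw [h1.deriv_eq, deriv_const]

theorem deriv_smoothStep_of_gt {n a t : ℝ} (hn : 0 < n) (h : a + 1 / n < t) :
    deriv (smoothStep n a) t = 0 := by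
  have h1 : smoothStep n a =ᶠ[𝓝 t] fun _ => 1 := by
    filter_upwards [Ioi_mem_nhds h] with x hx using smoothStep_of_ge hn (le_of_lt hx)
  rw [h1.deriv_eq, deriv_const]

theorem continuous_deriv_smoothStep (n a : ℝ) : Continuous (deriv (smoothStep n a)) :=
  (contDiff_smoothStep n a).continuous_deriv (by exact_mod_cast le_top)

/-- The derivatives of the steps are nonnegative, have integral one and live on [a, a + 1/(k+1)]: a
one-sided approximate identity, contained in [0, a + 1]. -/
theorem tendsto_setIntegral_mul_deriv_smoothStep {f : ℝ → ℝ} (hf : ContinuousOn f (Ici 0)) {a : ℝ}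
    (ha : 0 < a) :
    Tendsto (fun k : ℕ => ∫ t in Ioi (0 : ℝ), f t * deriv (smoothStep (k + 1) a) t) atTop
      (𝓝 (f a)) := by
  have hs : Icc 0 (a + 1) ∈ 𝓝[Icc 0 (a + 1)] a := self_mem_nhdsWithin
  have ha1 : a ∈ Icc 0 (a + 1) := ⟨ha.le, by linarith⟩
  have hfc : ContinuousOn f (Icc 0 (a + 1)) := hf.mono Icc_subset_Ici_self
  have h := tendsto_setIntegral_peak_smul_of_integrableOn_of_tendsto (l := atTop)
    (φ := fun (k : ℕ) t => deriv (smoothStep (k + 1) a) t) (μ := volume)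
    (measurableSet_Icc (a := (0 : ℝ)) (b := a + 1)) measurableSet_Icc subset_rfl hs
    measure_Icc_lt_top.ne
    (Eventually.of_forall fun k x _ => deriv_smoothStep_nonneg (by positivity) a x)
    ?_ ?_ (Eventually.of_forall fun k => (continuous_deriv_smoothStep _ a).aestronglyMeasurable)
    hfc.integrableOn_Icc (hfc a ha1)
  · refine h.congr fun k => ?_
    have hk : (0 : ℝ) < k + 1 := by positivity
    have hk1 : 1 / ((k : ℝ) + 1) ≤ 1 := by
      rw [div_le_one hk]
      linarith [(Nat.cast_nonneg k : (0 : ℝ) ≤ k)]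
    rw [integral_Icc_eq_integral_Ioc]
    have e : ∫ t in Ioi (0 : ℝ), f t * deriv (smoothStep (k + 1) a) t =
        ∫ t in Ioc (0 : ℝ) (a + 1), f t * deriv (smoothStep (k + 1) a) t := by
      refine (setIntegral_eq_of_subset_of_forall_sdiff_eq_zero measurableSet_Ioi
        Ioc_subset_Ioi_self fun x hx => ?_)
      have hx1 : a + 1 < x := by
        by_contra hcon
        exact hx.2 ⟨hx.1, not_lt.1 hcon⟩
      rw [deriv_smoothStep_of_gt hk (by linarith), mul_zero]
    rw [e]
    exact integral_congr_ae (Eventually.of_forall fun t => by simp [mul_comm])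
  · intro u hu hau
    obtain ⟨δ, hδ, hball⟩ := Metric.isOpen_iff.1 hu a hau
    obtain ⟨n, hn⟩ := exists_nat_gt (1 / δ)
    refine Metric.tendstoUniformlyOn_iff.2 fun ε hε => ?_
    filter_upwards [eventually_ge_atTop n] with k hk x hx
    have hk0 : (0 : ℝ) < k + 1 := by positivity
    have hkn : (n : ℝ) ≤ k := by exact_mod_cast hk
    have hkδ : 1 / ((k : ℝ) + 1) < δ := by
      rw [div_lt_iff₀ hk0]
      rw [div_lt_iff₀ hδ] at hn
      nlinarith
    have hxa : δ ≤ |x - a| := by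
      by_contra hcon
      exact hx.2 (hball (by simpa [Real.dist_eq] using hcon))
    have : deriv (smoothStep (k + 1) a) x = 0 := by
      rcases lt_or_ge x a with h1 | h1
      · exact deriv_smoothStep_of_lt hk0.le h1
      · rw [abs_of_nonneg (by linarith)] at hxa
        exact deriv_smoothStep_of_gt hk0 (by linarith)
    simpa [this] using hε
  · refine tendsto_const_nhds.congr fun k => ?_
    have hk : (0 : ℝ) < k + 1 := by positivity
    have hk1 : 1 / ((k : ℝ) + 1) ≤ 1 := by
      rw [div_le_one hk]
      linarith [(Nat.cast_nonneg k : (0 : ℝ) ≤ k)]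
    rw [integral_Icc_eq_integral_Ioc, ← intervalIntegral.integral_of_le (by linarith),
      intervalIntegral.integral_deriv_eq_sub
        (fun x _ => ((contDiff_smoothStep _ a).differentiable (by simp)) x)
        ((continuous_deriv_smoothStep _ a).intervalIntegrable _ _),
      smoothStep_of_ge hk (by linarith), smoothStep_of_le hk.le ha.le, sub_zero]

/-- The limit at t = a is 0, which is why the difference of two such limits is the indicator of a
half-open interval `Ioc`. -/
theorem tendsto_smoothStep {a t : ℝ} :
    Tendsto (fun k : ℕ => smoothStep (k + 1) a t) atTop (𝓝 (if a < t then 1 else 0)) := by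
  split_ifs with h
  · obtain ⟨n, hn⟩ := exists_nat_gt (1 / (t - a))
    refine tendsto_const_nhds.congr' ?_
    filter_upwards [eventually_ge_atTop n] with k hk
    have hk0 : (0 : ℝ) < k + 1 := by positivity
    have hkn : (n : ℝ) ≤ k := by exact_mod_cast hk
    have ht : 0 < t - a := by linarith
    refine (smoothStep_of_ge hk0 ?_).symm
    have : 1 / ((k : ℝ) + 1) ≤ t - a := by
      rw [div_le_iff₀ hk0]
      rw [div_lt_iff₀ ht] at hn
      nlinarith
    linarith
  · refine tendsto_const_nhds.congr fun k => (smoothStep_of_le (by positivity) (not_lt.1 h)).symm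

/-- A continuous function with locally integrable weak derivative is the integral of this
derivative. -/
theorem sub_eq_setIntegral_of_weakDeriv {f g : ℝ → ℝ} (hf : ContinuousOn f (Ici 0))
    (hg : ∀ T, 0 < T → IntegrableOn g (Ioo 0 T))
    (h : ∀ η : ℝ → ℝ, ContDiff ℝ ∞ η → HasCompactSupport η → tsupport η ⊆ Ioi 0 →
      ∫ t in Ioi (0 : ℝ), f t * deriv η t = -∫ t in Ioi (0 : ℝ), g t * η t)
    {s T : ℝ} (hs : 0 < s) (hsT : s ≤ T) : f T - f s = ∫ r in Ioc s T, g r := by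
  have hT : 0 < T := hs.trans_le hsT
  -- A smoothed indicator of (s, T]. Its support in [s, T + 1] stays away from 0 because s > 0.
  set η : ℕ → ℝ → ℝ := fun k t => smoothStep (k + 1) s t - smoothStep (k + 1) T t with hη
  have hzero : ∀ k t, t ∉ Icc s (T + 1) → η k t = 0 := by
    intro k t ht
    have hk : (0 : ℝ) < k + 1 := by positivity
    have hk1 : 1 / ((k : ℝ) + 1) ≤ 1 := by
      rw [div_le_one hk]
      linarith [(Nat.cast_nonneg k : (0 : ℝ) ≤ k)]
    simp only [hη]
    rcases lt_or_ge t s with h1 | h1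
    · rw [smoothStep_of_le hk.le h1.le, smoothStep_of_le hk.le (h1.le.trans hsT), sub_zero]
    · have h2 : T + 1 < t := by
        by_contra hcon
        exact ht ⟨h1, not_lt.1 hcon⟩
      rw [smoothStep_of_ge hk (by linarith), smoothStep_of_ge hk (by linarith), sub_self]
  have hsupp : ∀ k, tsupport (η k) ⊆ Icc s (T + 1) := fun k =>
    closure_minimal (fun t ht => by
      by_contra hcon
      exact ht (hzero k t hcon)) isClosed_Icc
  have hint : ∀ (k : ℕ) (a : ℝ), 0 < a →
      IntegrableOn (fun t => f t * deriv (smoothStep (k + 1) a) t) (Ioi 0) := by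
    intro k a ha
    have hk : (0 : ℝ) < k + 1 := by positivity
    have h1 : IntegrableOn (fun t => f t * deriv (smoothStep (k + 1) a) t)
        (Ioc 0 (a + 1 / ((k : ℝ) + 1))) :=
      ((hf.mono Icc_subset_Ici_self).mul
        (continuous_deriv_smoothStep _ a).continuousOn).integrableOn_Icc.mono_set
          Ioc_subset_Icc_self
    rw [← Ioc_union_Ioi_eq_Ioi (b := a + 1 / ((k : ℝ) + 1)) (by positivity)]
    refine h1.union ((integrableOn_zero).congr_fun (fun t ht => ?_) measurableSet_Ioi)
    rw [deriv_smoothStep_of_gt hk ht, mul_zero]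
  have hid : ∀ k : ℕ, (∫ t in Ioi (0 : ℝ), f t * deriv (smoothStep (k + 1) s) t) -
      (∫ t in Ioi (0 : ℝ), f t * deriv (smoothStep (k + 1) T) t) =
      -∫ t in Ioo (0 : ℝ) (T + 2), g t * η k t := by
    intro k
    have h1 := h (η k) ((contDiff_smoothStep _ s).sub (contDiff_smoothStep _ T))
      (isCompact_Icc.of_isClosed_subset (isClosed_tsupport _) (hsupp k))
      ((hsupp k).trans fun t ht => hs.trans_le ht.1)
    rw [← integral_sub (hint k s hs) (hint k T hT)]
    have h2 : ∫ t in Ioi (0 : ℝ), g t * η k t = ∫ t in Ioo (0 : ℝ) (T + 2), g t * η k t := by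
      refine setIntegral_eq_of_subset_of_forall_sdiff_eq_zero measurableSet_Ioi
        Ioo_subset_Ioi_self fun x hx => ?_
      rw [hzero k x fun hx2 => hx.2 ⟨hx.1, by linarith [hx2.2]⟩, mul_zero]
    rw [← h2, ← h1]
    refine integral_congr_ae (Eventually.of_forall fun t => ?_)
    have h3 : deriv (η k) t = deriv (smoothStep (k + 1) s) t - deriv (smoothStep (k + 1) T) t :=
      deriv_fun_sub ((contDiff_smoothStep _ s).differentiable (by simp) t)
        ((contDiff_smoothStep _ T).differentiable (by simp) t)
    simp only [h3]
    ring
  have hlim1 := (tendsto_setIntegral_mul_deriv_smoothStep hf hs).sub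
    (tendsto_setIntegral_mul_deriv_smoothStep hf hT)
  have hgT := hg (T + 2) (by linarith)
  have hlim2 : Tendsto (fun k : ℕ => ∫ t in Ioo (0 : ℝ) (T + 2), g t * η k t) atTop
      (𝓝 (∫ t in Ioo (0 : ℝ) (T + 2), (Ioc s T).indicator g t)) := by
    refine tendsto_integral_of_dominated_convergence (fun t => |g t|) (fun k => ?_) hgT.abs
      (fun k => Eventually.of_forall fun t => ?_) (Eventually.of_forall fun t => ?_)
    · exact hgT.aestronglyMeasurable.mul (((contDiff_smoothStep _ s).sub
        (contDiff_smoothStep _ T)).continuous.aestronglyMeasurable)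
    · rw [norm_mul, Real.norm_eq_abs]
      refine mul_le_of_le_one_right (abs_nonneg _) (abs_le.2 ⟨?_, ?_⟩)
      · linarith [smoothStep_nonneg (k + 1) s t, smoothStep_le_one (k + 1) T t]
      · linarith [smoothStep_nonneg (k + 1) T t, smoothStep_le_one (k + 1) s t]
    · have h1 := ((tendsto_smoothStep (a := s) (t := t)).sub
        (tendsto_smoothStep (a := T) (t := t))).const_mul (g t)
      convert h1 using 2
      by_cases hts : s < t
      · by_cases htT : T < t
        · simp [hts, htT, indicator, not_le.2 htT]
        · simp [hts, htT, indicator, not_lt.1 htT]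
      · have htT : ¬ T < t := fun h => hts (hsT.trans_lt h)
        simp [hts, htT, indicator]
  have hlim3 := hlim2.neg
  have huniq := tendsto_nhds_unique hlim1 (hlim3.congr fun k => (hid k).symm)
  have hsub : Ioc s T ⊆ Ioo 0 (T + 2) := fun t ht => ⟨hs.trans ht.1, by linarith [ht.2]⟩
  rw [setIntegral_indicator measurableSet_Ioc, inter_eq_self_of_subset_right hsub] at huniq
  linarith

end WeakDerivative

/-! ### The abstract energy identity, by difference quotients in time. -/

section Energy

section Translation

variable {X : Type*} [NormedAddCommGroup X]

/-- The translate `t ↦ F (h + t)` of an element of `L²(ℝ)`. -/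
def translate (h : ℝ) (F : Lp X 2 (volume : Measure ℝ)) : Lp X 2 (volume : Measure ℝ) :=
  DomAddAct.mk h +ᵥ F

theorem continuous_translate (F : Lp X 2 (volume : Measure ℝ)) :
    Continuous fun h => translate h F := by
  have : Fact ((2 : ENNReal) ≠ ⊤) := ⟨by norm_num⟩
  exact DomAddAct.continuous_mk.vadd continuous_const

theorem coeFn_translate (h : ℝ) (F : Lp X 2 (volume : Measure ℝ)) :
    translate h F =ᵐ[volume] fun t => F (h + t) :=
  DomAddAct.vadd_Lp_ae_eq _ _

end Translation

variable {X : Type*} [NormedAddCommGroup X] [NormedSpace ℝ X]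

/-- `∫_S ⟨W(t + r), V(t + h)⟩ dt`. -/
def shiftedPairing (S : Set ℝ) (W : Lp (StrongDual ℝ X) 2 (volume : Measure ℝ))
    (V : Lp X 2 (volume : Measure ℝ)) (r h : ℝ) : ℝ :=
  ∫ t in S, W (r + t) (V (h + t))

/-- Translations are continuous in L²(ℝ) and the duality pairing is bounded bilinear. This replaces
any mollification in time. -/
theorem continuous_shiftedPairing (S : Set ℝ)
    (W : Lp (StrongDual ℝ X) 2 (volume : Measure ℝ)) (V : Lp X 2 (volume : Measure ℝ)) :
    Continuous fun p : ℝ × ℝ => shiftedPairing S W V p.1 p.2 := by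
  have e : ∀ p : ℝ × ℝ, shiftedPairing S W V p.1 p.2 =
      ContinuousLinearMap.lpPairing (volume.restrict S) 2 2
        (ContinuousLinearMap.id ℝ (StrongDual ℝ X))
        (LpToLpRestrictCLM ℝ (StrongDual ℝ X) ℝ volume 2 S (translate p.1 W))
        (LpToLpRestrictCLM ℝ X ℝ volume 2 S (translate p.2 V)) := by
    intro p
    rw [ContinuousLinearMap.lpPairing_eq_integral]
    refine integral_congr_ae ?_
    filter_upwards [LpToLpRestrictCLM_coeFn ℝ S (translate p.1 W),
      LpToLpRestrictCLM_coeFn ℝ S (translate p.2 V), ae_restrict_of_ae (coeFn_translate p.1 W),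
      ae_restrict_of_ae (coeFn_translate p.2 V)] with t h1 h2 h3 h4
    rw [h1, h2, h3, h4]
    rfl
  simp_rw [e]
  have h1 := (LpToLpRestrictCLM ℝ (StrongDual ℝ X) ℝ volume 2 S).continuous.comp
    ((continuous_translate W).comp (continuous_fst (X := ℝ) (Y := ℝ)))
  have h2 := (LpToLpRestrictCLM ℝ X ℝ volume 2 S).continuous.comp
    ((continuous_translate V).comp (continuous_snd (X := ℝ) (Y := ℝ)))
  exact ((ContinuousLinearMap.continuous _).comp h1).clm_apply h2

theorem stronglyMeasurable_dual_apply {α : Type*} [MeasurableSpace α] {f : α → StrongDual ℝ X}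
    {g : α → X} (hf : StronglyMeasurable f) (hg : StronglyMeasurable g) :
    StronglyMeasurable fun x => f x (g x) :=
  (isBoundedBilinearMap_apply (𝕜 := ℝ) (E := X) (F := ℝ)).continuous.comp_stronglyMeasurable
    (hf.prodMk hg)

theorem integral_norm_sq_integrable {Y : Type*} [NormedAddCommGroup Y]
    (V : Lp Y 2 (volume : Measure ℝ)) : Integrable fun t => ‖V t‖ ^ 2 :=
  (Lp.memLp V).integrable_norm_pow (by norm_num)

/-- The pairing is dominated by ‖W‖² + ‖V‖²; the first term is integrable because the shear (t, r) ↦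
(t, t + r) preserves the product measure. This licenses Fubini. -/
theorem integrable_shifted (W : Lp (StrongDual ℝ X) 2 (volume : Measure ℝ))
    (V : Lp X 2 (volume : Measure ℝ)) (s T d h : ℝ) :
    Integrable (Function.uncurry fun t r : ℝ => W (r + t) (V (h + t)))
      ((volume.restrict (Ioc s T)).prod (volume.restrict (Ioc 0 d))) := by
  have hmeas : StronglyMeasurable (Function.uncurry fun t r : ℝ => W (r + t) (V (h + t))) := by
    refine stronglyMeasurable_dual_apply
      ((Lp.stronglyMeasurable W).comp_measurable (g := fun p : ℝ × ℝ => p.2 + p.1) (by fun_prop))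
      ((Lp.stronglyMeasurable V).comp_measurable (g := fun p : ℝ × ℝ => h + p.1) (by fun_prop))
  have h1 : Integrable (fun p : ℝ × ℝ => ‖W (p.2 + p.1)‖ ^ 2)
      ((volume.restrict (Ioc s T)).prod (volume.restrict (Ioc 0 d))) := by
    have h2 := (integral_norm_sq_integrable W).comp_snd (volume.restrict (Ioc s T))
    have h3 := (measurePreserving_prod_add (volume.restrict (Ioc s T))
      (volume : Measure ℝ)).integrable_comp_of_integrable h2
    refine (h3.mono_measure (Measure.prod_mono le_rfl Measure.restrict_le_self)).congr
      (Eventually.of_forall fun p => ?_)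
    simp [add_comm]
  have h2 : Integrable (fun p : ℝ × ℝ => ‖V (h + p.1)‖ ^ 2)
      ((volume.restrict (Ioc s T)).prod (volume.restrict (Ioc 0 d))) := by
    have h3 := (measurePreserving_add_left volume h).integrable_comp_of_integrable
      (integral_norm_sq_integrable V)
    exact (h3.integrableOn (s := Ioc s T)).comp_fst (volume.restrict (Ioc 0 d))
  refine (h1.add h2).mono' hmeas.aestronglyMeasurable (Eventually.of_forall fun p => ?_)
  refine ((W (p.2 + p.1)).le_opNorm _).trans ?_
  simp only [Pi.add_apply]
  nlinarith [sq_nonneg (‖W (p.2 + p.1)‖ - ‖V (h + p.1)‖), norm_nonneg (W (p.2 + p.1)),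
    norm_nonneg (V (h + p.1))]

theorem tendsto_average {G : ℝ × ℝ → ℝ} (hG : Continuous G) :
    Tendsto (fun h : ℝ => h⁻¹ * ∫ r in (0 : ℝ)..h, G (r, h)) (𝓝[>] 0) (𝓝 (G (0, 0))) := by
  refine Metric.tendsto_nhds.2 fun ε hε => ?_
  obtain ⟨δ, hδ, hclose⟩ := Metric.continuousAt_iff.1 (hG.continuousAt (x := (0, 0))) (ε / 2)
    (by positivity)
  filter_upwards [Ioo_mem_nhdsGT hδ] with h hh
  have h0 : 0 < h := hh.1
  have hi : IntervalIntegrable (fun r => G (r, h)) volume 0 h :=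
    (hG.comp (by fun_prop : Continuous fun r : ℝ => (r, h))).intervalIntegrable _ _
  have e : h⁻¹ * (∫ r in (0 : ℝ)..h, G (r, h)) - G (0, 0) =
      h⁻¹ * ∫ r in (0 : ℝ)..h, (G (r, h) - G (0, 0)) := by
    rw [intervalIntegral.integral_sub hi (by simp), intervalIntegral.integral_const]
    simp only [sub_zero, smul_eq_mul]
    field_simp
  have hb : ‖∫ r in (0 : ℝ)..h, (G (r, h) - G (0, 0))‖ ≤ ε / 2 * |h - 0| := by
    refine intervalIntegral.norm_integral_le_of_norm_le_const fun r hr => ?_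
    rw [uIoc_of_le h0.le] at hr
    have : dist (r, h) ((0 : ℝ), (0 : ℝ)) < δ := by
      rw [Prod.dist_eq, max_lt_iff, Real.dist_eq, Real.dist_eq, sub_zero, sub_zero,
        abs_of_pos hr.1, abs_of_pos h0]
      exact ⟨hr.2.trans_lt hh.2, hh.2⟩
    exact (hclose this).le
  rw [Real.dist_eq, e, abs_mul, abs_of_pos (inv_pos.2 h0)]
  rw [sub_zero, abs_of_pos h0, Real.norm_eq_abs] at hb
  calc h⁻¹ * |∫ r in (0 : ℝ)..h, (G (r, h) - G (0, 0))| ≤ h⁻¹ * (ε / 2 * h) :=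
        mul_le_mul_of_nonneg_left hb (inv_pos.2 h0).le
    _ = ε / 2 := by field_simp
    _ < ε := by linarith

theorem tendsto_average_sub {y : ℝ → ℝ} (hy : ContinuousOn y (Ici 0)) {s T : ℝ} (hs : 0 < s)
    (hsT : s ≤ T) :
    Tendsto (fun h : ℝ => h⁻¹ * ∫ t in Ioc s T, (y (h + t) - y t)) (𝓝[>] 0)
      (𝓝 (y T - y s)) := by
  -- Extending y by y(0) to negative times makes it continuous on ℝ, so its primitive is
  -- differentiable everywhere.
  set Y : ℝ → ℝ := fun t => y (max t 0) with hY
  have hYc : Continuous Y :=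
    hy.comp_continuous (by fun_prop) fun t => le_max_right t 0
  have hYy : ∀ t, 0 ≤ t → Y t = y t := fun t ht => by simp [hY, ht]
  have hder : ∀ b, HasDerivAt (fun b => ∫ x in (0 : ℝ)..b, Y x) (Y b) b := fun b =>
    (hYc.integral_hasStrictDerivAt 0 b).hasDerivAt
  have h1 := ((hder T).tendsto_slope_zero_right).sub ((hder s).tendsto_slope_zero_right)
  rw [hYy T (hs.le.trans hsT), hYy s hs.le] at h1
  refine h1.congr' ?_
  filter_upwards [self_mem_nhdsWithin] with h hh
  have hh0 : 0 < h := hh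
  have e1 : ∫ t in Ioc s T, (y (h + t) - y t) = ∫ t in s..T, (Y (h + t) - Y t) := by
    rw [intervalIntegral.integral_of_le hsT]
    refine setIntegral_congr_fun measurableSet_Ioc fun t ht => ?_
    have : 0 < t := hs.trans ht.1
    rw [hYy t this.le, hYy (h + t) (by linarith)]
  have hint : ∀ a b, IntervalIntegrable Y volume a b := fun a b => hYc.intervalIntegrable a b
  have e2 : ∫ t in s..T, Y (h + t) = ∫ t in (h + s)..(h + T), Y t :=
    intervalIntegral.integral_comp_add_left Y h
  have hsh : IntervalIntegrable (fun t => Y (h + t)) volume s T :=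
    (hYc.comp (by fun_prop : Continuous fun t : ℝ => h + t)).intervalIntegrable _ _
  rw [e1, intervalIntegral.integral_sub hsh (hint _ _), e2, smul_eq_mul, smul_eq_mul, ← mul_sub]
  have e3 := intervalIntegral.integral_interval_sub_left (hint 0 (h + T)) (hint 0 (h + s))
  have e4 := intervalIntegral.integral_interval_sub_left (hint 0 T) (hint 0 s)
  rw [← e3, ← e4, add_comm T, add_comm s]
  ring

variable {H : Type*} [NormedAddCommGroup H] [InnerProductSpace ℝ H]

/-- The energy identity for a function with values in `X` whose weak time derivative is square
integrable with values in the dual of `X`. -/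
theorem norm_sq_sub_eq_integral {ι : X → H} {u : ℝ → H} (hu : ContinuousOn u (Ici 0))
    {U : ℝ → X} (hU : L2Loc U) {w : ℝ → StrongDual ℝ X} (hw : L2Loc w)
    (hUu : ∀ᵐ t ∂volume.restrict (Ioi (0 : ℝ)), ι (U t) = u t)
    (hd : ∀ v s T, 0 < s → s ≤ T →
      inner ℝ (u T) (ι v) - inner ℝ (u s) (ι v) = ∫ r in Ioc s T, w r v)
    {s T : ℝ} (hs : 0 < s) (hsT : s ≤ T) :
    ‖u T‖ ^ 2 - ‖u s‖ ^ 2 = 2 * ∫ t in Ioc s T, w t (U t) := by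
  -- The cutoffs extend to T + 1 so that shifts of (s, T] by h < 1 still see the true U and w.
  have hT : 0 < T + 1 := by linarith
  have hUm : MemLp ((Ioo 0 (T + 1)).indicator U) 2 volume :=
    (memLp_indicator_iff_restrict measurableSet_Ioo).2 (hU (T + 1) hT)
  have hwm : MemLp ((Ioo 0 (T + 1)).indicator w) 2 volume :=
    (memLp_indicator_iff_restrict measurableSet_Ioo).2 (hw (T + 1) hT)
  set V := hUm.toLp with hV
  set W := hwm.toLp with hW
  have hVU : ∀ᵐ t, t ∈ Ioo 0 (T + 1) → V t = U t := by
    filter_upwards [hUm.coeFn_toLp] with t h1 h2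
    rw [h1, indicator_of_mem h2]
  have hWw : ∀ᵐ t, t ∈ Ioo 0 (T + 1) → W t = w t := by
    filter_upwards [hwm.coeFn_toLp] with t h1 h2
    rw [h1, indicator_of_mem h2]
  have hVu : ∀ᵐ t, t ∈ Ioo 0 (T + 1) → ι (V t) = u t := by
    rw [ae_restrict_iff' measurableSet_Ioi] at hUu
    filter_upwards [hVU, hUu] with t h1 h2 h3
    rw [h1 h3, h2 h3.1]
  have hWv : ∀ (v : X) (t h : ℝ), 0 < t → 0 < h → t + h < T + 1 →
      ∫ r in (0 : ℝ)..h, W (r + t) v = inner ℝ (u (h + t)) (ι v) - inner ℝ (u t) (ι v) := by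
    intro v t h ht hh hth
    rw [hd v t (h + t) ht (by linarith), intervalIntegral.integral_comp_add_right
      (fun r => W r v) t, zero_add, intervalIntegral.integral_of_le (by linarith)]
    refine setIntegral_congr_ae measurableSet_Ioc ?_
    filter_upwards [hWw] with r h1 h2
    rw [h1 ⟨ht.trans h2.1, by linarith [h2.2]⟩]
  -- Integrate ‖u(t+h)‖² - ‖u(t)‖² = ⟨u(t+h) - u(t), u(t) + u(t+h)⟩ and express the increment as the
  -- integral of w over (t, t + h]. Dividing by h and letting h → 0, both pairings tend to ∫ w(U),
  -- whence the factor 2.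
  have hid : ∀ h, 0 < h → h < 1 → ∫ t in Ioc s T, (‖u (h + t)‖ ^ 2 - ‖u t‖ ^ 2) =
      ∫ r in (0 : ℝ)..h, (shiftedPairing (Ioc s T) W V r 0 +
        shiftedPairing (Ioc s T) W V r h) := by
    intro h h0 h1
    have hshift : ∀ᵐ t, h + t ∈ Ioo 0 (T + 1) → ι (V (h + t)) = u (h + t) :=
      (measurePreserving_add_left volume h).quasiMeasurePreserving.ae hVu
    have i0 := integrable_shifted W V s T h 0
    have i1 := integrable_shifted W V s T h h
    have e1 : ∫ t in Ioc s T, (‖u (h + t)‖ ^ 2 - ‖u t‖ ^ 2) =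
        ∫ t in Ioc s T, ((∫ r in Ioc 0 h, W (r + t) (V (0 + t))) +
          ∫ r in Ioc 0 h, W (r + t) (V (h + t))) := by
      refine setIntegral_congr_ae measurableSet_Ioc ?_
      filter_upwards [hVu, hshift] with t h2 h3 ht
      have ht0 : 0 < t := hs.trans ht.1
      have ht1 : t + h < T + 1 := by linarith [ht.2]
      -- The increment formula holds for every vector v, so at fixed t it applies to V(t) and V(h +
      -- t) without a further exceptional set.
      rw [← intervalIntegral.integral_of_le h0.le, ← intervalIntegral.integral_of_le h0.le,
        hWv _ t h ht0 h0 ht1, hWv _ t h ht0 h0 ht1, zero_add, h2 ⟨ht0, by linarith⟩,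
        h3 ⟨by linarith, by linarith⟩, real_inner_self_eq_norm_sq, real_inner_self_eq_norm_sq,
        real_inner_comm (u t)]
      ring
    refine e1.trans ((integral_add i0.integral_prod_left i1.integral_prod_left).trans ?_)
    refine (congrArg₂ (· + ·) (integral_integral_swap i0) (integral_integral_swap i1)).trans ?_
    rw [intervalIntegral.integral_of_le h0.le]
    exact (integral_add i0.integral_prod_right i1.integral_prod_right).symm
  have hcont : Continuous fun p : ℝ × ℝ => shiftedPairing (Ioc s T) W V p.1 0 +
      shiftedPairing (Ioc s T) W V p.1 p.2 := by
    have h1 := continuous_shiftedPairing (Ioc s T) W V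
    exact (h1.comp (by fun_prop : Continuous fun p : ℝ × ℝ => (p.1, (0 : ℝ)))).add h1
  have hlim := tendsto_average hcont
  have hlim2 := tendsto_average_sub (y := fun t => ‖u t‖ ^ 2) (hu.norm.pow 2) hs hsT
  have heq : ∀ᶠ h : ℝ in 𝓝[>] 0, h⁻¹ * ∫ t in Ioc s T, (‖u (h + t)‖ ^ 2 - ‖u t‖ ^ 2) =
      h⁻¹ * ∫ r in (0 : ℝ)..h, (shiftedPairing (Ioc s T) W V r 0 +
        shiftedPairing (Ioc s T) W V r h) := by
    filter_upwards [Ioo_mem_nhdsGT (zero_lt_one' ℝ)] with h hh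
    rw [hid h hh.1 hh.2]
  rw [tendsto_nhds_unique hlim2 (hlim.congr' (heq.mono fun _ h => h.symm)), ← two_mul]
  congr 1
  unfold shiftedPairing
  refine setIntegral_congr_ae measurableSet_Ioc ?_
  filter_upwards [hVU, hWw] with t h1 h2 ht
  have : t ∈ Ioo 0 (T + 1) := ⟨hs.trans ht.1, by linarith [ht.2]⟩
  rw [zero_add, h1 this, h2 this]

end Energy

/-! ### Measurability of the nonlinear terms. -/

section Measurability

/-- Clear for simple g, where only finitely many frozen arguments occur; then approximate g
pointwise and use continuity in the second argument. -/
theorem aemeasurable_caratheodory {α ι : Type*} [MeasurableSpace α] [Finite ι] {μ : Measure α}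
    {F : α → (ι → ℝ) → ℝ} (hF : ∀ ξ, AEMeasurable (fun x => F x ξ) μ)
    (hc : ∀ᵐ x ∂μ, Continuous (F x)) {g : α → ι → ℝ} (hg : AEMeasurable g μ) :
    AEMeasurable (fun x => F x (g x)) μ := by
  have hsimple : ∀ s : SimpleFunc α (ι → ℝ), AEMeasurable (fun x => F x (s x)) μ := by
    intro s
    have e : (fun x => F x (s x)) =
        ∑ c ∈ s.range, (s ⁻¹' {c}).indicator fun x => F x c := by
      funext x
      rw [Finset.sum_apply, Finset.sum_eq_single (s x)]
      · simp
      · intro c _ hc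
        exact indicator_of_notMem (fun h => hc (by simpa using h.symm)) _
      · intro h
        exact absurd (SimpleFunc.mem_range_self s x) h
    rw [e]
    exact Finset.aemeasurable_sum _ fun c _ => (hF c).indicator (s.measurableSet_preimage _)
  have hm := hg.measurable_mk.stronglyMeasurable
  have h1 : AEMeasurable (fun x => F x (hg.mk g x)) μ := by
    refine aemeasurable_of_tendsto_metrizable_ae atTop (fun n => hsimple (hm.approx n)) ?_
    filter_upwards [hc] with x hx
    exact (hx.tendsto _).comp (hm.tendsto_approx x)
  refine h1.congr ?_
  filter_upwards [hg.ae_eq_mk] with x hx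
  rw [hx]

theorem aemeasurable_comp_of_lowerSemicontinuous {α Y : Type*} [MeasurableSpace α]
    {μ : Measure α} [NormedAddCommGroup Y] {G : Y → ENNReal} (hG : LowerSemicontinuous G)
    {f : α → Y} (hf : AEStronglyMeasurable f μ) : AEMeasurable (fun x => G (f x)) μ := by
  borelize Y
  exact hG.measurable.comp_aemeasurable hf.aemeasurable

theorem exists_subseq_tendsto_ae {N m : ℕ} {Ω : Set (Sp N)} {v : ℕ → Jets Ω m} {v₀ : Jets Ω m}
    (hv : Tendsto v atTop (𝓝 v₀)) :
    ∃ ns : ℕ → ℕ, StrictMono ns ∧ ∀ᵐ x ∂volume.restrict Ω, ∀ γ : MIdx N m,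
      Tendsto (fun k => v (ns k) γ x) atTop (𝓝 (v₀ γ x)) := by
  suffices h : ∀ S : Finset (MIdx N m), ∃ ns : ℕ → ℕ, StrictMono ns ∧
      ∀ γ ∈ S, ∀ᵐ x ∂volume.restrict Ω, Tendsto (fun k => v (ns k) γ x) atTop (𝓝 (v₀ γ x)) by
    obtain ⟨ns, h1, h2⟩ := h Finset.univ
    exact ⟨ns, h1, ae_all_iff.2 fun γ => h2 γ (Finset.mem_univ γ)⟩
  intro S
  induction S using Finset.induction_on with
  | empty => exact ⟨id, strictMono_id, by simp⟩
  | insert γ S _ ih =>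
    obtain ⟨ns, h1, h2⟩ := ih
    have h3 : Tendsto (fun k => v (ns k) γ) atTop (𝓝 (v₀ γ)) :=
      (((PiLp.continuous_apply 2 (fun _ : MIdx N m => L2 Ω) γ).tendsto v₀).comp hv).comp
        h1.tendsto_atTop
    obtain ⟨ms, h4, h5⟩ := (tendstoInMeasure_of_tendsto_Lp h3).exists_seq_tendsto_ae
    refine ⟨ns ∘ ms, h1.comp h4, fun β hβ => ?_⟩
    rcases Finset.mem_insert.1 hβ with rfl | hβ
    · exact h5
    · filter_upwards [h2 β hβ] with x hx
      exact hx.comp h4.tendsto_atTop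

end Measurability

/-! ### Measurability, bounds and coercivity of the energy. -/

section EnergyDensity

variable {N m : ℕ} {Ω : Set (Sp N)}

/-- The energy density `∑_{|α| = m} a_α(x, v, …, D^m v) D^α v + a |v|^{q+1}`. -/
def energyDensity (A : MIdx N m → Sp N → (MIdx N m → ℝ) → ℝ) (a : Sp N → ℝ) (q : ℝ)
    (v : Jets Ω m) (x : Sp N) : ℝ :=
  (∑ α ∈ topIdx N m, A α x (fun γ => v γ x) * v α x) + a x * |v (zeroIdx N m) x| ^ (q + 1)

variable {A : MIdx N m → Sp N → (MIdx N m → ℝ) → ℝ} {a : Sp N → ℝ} {q : ℝ}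

theorem aemeasurable_energyDensity (hΩo : IsOpen Ω) (hA : StructureCondition Ω A)
    (ham : AEMeasurable a (volume.restrict Ω)) (v : Jets Ω m) :
    AEMeasurable (energyDensity A a q v) (volume.restrict Ω) := by
  have hv : ∀ γ, AEMeasurable (v γ) (volume.restrict Ω) := fun γ =>
    (Lp.aestronglyMeasurable (v γ)).aemeasurable
  have hsum := Finset.aemeasurable_sum (μ := volume.restrict Ω) (topIdx N m)
    (f := fun α x => A α x (fun γ => v γ x) * v α x) fun α hα => by
      refine AEMeasurable.mul (aemeasurable_caratheodory (hA.measurable α hα) ?_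
        (aemeasurable_pi_lambda _ hv)) (hv α)
      filter_upwards [ae_restrict_mem hΩo.measurableSet] with x hx using hA.continuous α hα x hx
  have e : energyDensity A a q v = (∑ α ∈ topIdx N m, fun x => A α x (fun γ => v γ x) * v α x) +
      fun x => a x * |v (zeroIdx N m) x| ^ (q + 1) := by
    funext x
    simp [energyDensity]
  rw [e]
  exact hsum.add (ham.mul ((hv _).norm.pow_const _))

/-- Fatou along an a.e. convergent subsequence. Semicontinuity is enough for Borel measurability,
hence for measurability of the energy of U(t) in time. -/
theorem lowerSemicontinuous_lintegral_energyDensity (hΩo : IsOpen Ω)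
    (hA : StructureCondition Ω A) (ham : AEMeasurable a (volume.restrict Ω)) (hq0 : 0 < q) :
    LowerSemicontinuous fun v : Jets Ω m =>
      ∫⁻ x in Ω, ENNReal.ofReal (energyDensity A a q v x) := by
  refine lowerSemicontinuous_iff_isClosed_preimage.2 fun c => IsSeqClosed.isClosed ?_
  intro v v₀ hv hlim
  obtain ⟨ns, -, hae⟩ := exists_subseq_tendsto_ae hlim
  have h1 : ∀ᵐ x ∂volume.restrict Ω, Tendsto (fun k => energyDensity A a q (v (ns k)) x) atTop
      (𝓝 (energyDensity A a q v₀ x)) := by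
    filter_upwards [hae, ae_restrict_mem hΩo.measurableSet] with x hx hxΩ
    refine (tendsto_finsetSum _ fun α hα => ?_).add
      (((hx (zeroIdx N m)).abs.rpow_const (Or.inr (by linarith))).const_mul _)
    exact (((hA.continuous α hα x hxΩ).tendsto _).comp (tendsto_pi_nhds.2 hx)).mul (hx α)
  calc ∫⁻ x in Ω, ENNReal.ofReal (energyDensity A a q v₀ x)
      = ∫⁻ x in Ω, liminf (fun k => ENNReal.ofReal (energyDensity A a q (v (ns k)) x)) atTop := by
        refine lintegral_congr_ae ?_
        filter_upwards [h1] with x hx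
        exact ((ENNReal.continuous_ofReal.tendsto _).comp hx).liminf_eq.symm
    _ ≤ liminf (fun k => ∫⁻ x in Ω, ENNReal.ofReal (energyDensity A a q (v (ns k)) x)) atTop :=
        lintegral_liminf_le' fun k =>
          (aemeasurable_energyDensity hΩo hA ham _).ennreal_ofReal
    _ ≤ c := liminf_le_of_le (by isBoundedDefault) fun b hb => by
        obtain ⟨k, hk⟩ := hb.exists
        exact hk.trans (hv (ns k))

theorem energyDensity_ge (hΩo : IsOpen Ω) {C : ℝ}
    (hC : ∀ x ∈ Ω, ∀ ξ : MIdx N m → ℝ,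
      C * ∑ γ ∈ topIdx N m, |ξ γ| ^ 2 ≤ ∑ α ∈ topIdx N m, A α x ξ * ξ α) (v : Jets Ω m) :
    ∀ᵐ x ∂volume.restrict Ω, C * ∑ γ ∈ topIdx N m, v γ x ^ 2 +
      a x * |v (zeroIdx N m) x| ^ (q + 1) ≤ energyDensity A a q v x := by
  filter_upwards [ae_restrict_mem hΩo.measurableSet] with x hx
  have := hC x hx fun γ => v γ x
  simp only [sq_abs] at this
  simp only [energyDensity]
  linarith

theorem energyDensity_nonneg (hΩo : IsOpen Ω) (hcoer : StronglyCoercive Ω A)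
    (ha0 : ∀ x ∈ Ω, 0 ≤ a x) (v : Jets Ω m) :
    0 ≤ᵐ[volume.restrict Ω] energyDensity A a q v := by
  obtain ⟨C, hC0, hC⟩ := hcoer
  filter_upwards [energyDensity_ge (a := a) (q := q) hΩo hC v,
    ae_restrict_mem hΩo.measurableSet] with x h1 hx
  have h2 := ha0 x hx
  have h3 : 0 ≤ ∑ γ ∈ topIdx N m, v γ x ^ 2 := Finset.sum_nonneg fun _ _ => sq_nonneg _
  refine le_trans ?_ h1
  simp only [Pi.zero_apply]
  positivity

/-- Quadratic growth, since products of top derivatives are dominated by squares and |v|^{q+1} ≤ v²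
+ 1. It makes the energy of a function in L²_loc(W₀^{m,2}) locally integrable in time. -/
theorem exists_integral_energyDensity_le (hΩo : IsOpen Ω) (hΩb : Bornology.IsBounded Ω)
    (hA : StructureCondition Ω A) (hcoer : StronglyCoercive Ω A)
    (ham : AEMeasurable a (volume.restrict Ω)) (ha0 : ∀ x ∈ Ω, 0 ≤ a x)
    (hab : ∃ K : ℝ, ∀ x ∈ Ω, a x ≤ K) (hq0 : 0 < q) (hq1 : q < 1) :
    ∃ C₁ C₂ : ℝ, ∀ v : Jets Ω m, Integrable (energyDensity A a q v) (volume.restrict Ω) ∧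
      ∫ x in Ω, energyDensity A a q v x ≤ C₁ * ‖v‖ ^ 2 + C₂ := by
  have hfin : IsFiniteMeasure (volume.restrict Ω) := ⟨by simpa using hΩb.measure_lt_top⟩
  obtain ⟨c, hc⟩ := hA.growth
  obtain ⟨K, hK⟩ := hab
  set n : ℝ := ((topIdx N m).card : ℝ) with hn
  refine ⟨|c| * (n * (n * 2)) + |K|, |K| * (volume.restrict Ω).real univ, fun v => ?_⟩
  set D : Sp N → ℝ := fun x => |c| * ∑ α ∈ topIdx N m, ∑ γ ∈ topIdx N m, (v γ x ^ 2 + v α x ^ 2) +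
    |K| * (v (zeroIdx N m) x ^ 2 + 1) with hD
  have hsq : ∀ γ, Integrable (fun x => v γ x ^ 2) (volume.restrict Ω) := fun γ =>
    (Lp.memLp (v γ)).integrable_sq
  have hi1 : ∀ α, Integrable (fun x => ∑ γ ∈ topIdx N m, (v γ x ^ 2 + v α x ^ 2))
      (volume.restrict Ω) := fun α => integrable_finsetSum _ fun γ _ => (hsq γ).add (hsq α)
  have hi2 : Integrable (fun x => ∑ α ∈ topIdx N m, ∑ γ ∈ topIdx N m, (v γ x ^ 2 + v α x ^ 2))
      (volume.restrict Ω) := integrable_finsetSum _ fun α _ => hi1 α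
  have hi3 : Integrable (fun x => v (zeroIdx N m) x ^ 2 + 1) (volume.restrict Ω) :=
    (hsq _).add (integrable_const 1)
  have hDint : Integrable D (volume.restrict Ω) := (hi2.const_mul _).add (hi3.const_mul _)
  have hle : ∀ᵐ x ∂volume.restrict Ω, energyDensity A a q v x ≤ D x := by
    filter_upwards [ae_restrict_mem hΩo.measurableSet] with x hx
    refine add_le_add ?_ ?_
    · rw [Finset.mul_sum]
      refine Finset.sum_le_sum fun α hα => ?_
      refine (le_abs_self _).trans ?_
      rw [abs_mul]
      have h1 : |A α x fun γ => v γ x| ≤ |c| * ∑ γ ∈ topIdx N m, |v γ x| :=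
        (hc α hα x hx _).trans (mul_le_mul_of_nonneg_right (le_abs_self c)
          (Finset.sum_nonneg fun _ _ => abs_nonneg _))
      refine (mul_le_mul_of_nonneg_right h1 (abs_nonneg _)).trans ?_
      rw [mul_assoc, Finset.sum_mul]
      refine mul_le_mul_of_nonneg_left (Finset.sum_le_sum fun γ _ => ?_) (abs_nonneg c)
      rw [← sq_abs (v γ x), ← sq_abs (v α x)]
      nlinarith [sq_nonneg (|v γ x| - |v α x|), abs_nonneg (v γ x), abs_nonneg (v α x)]
    · refine mul_le_mul ((hK x hx).trans (le_abs_self K)) ?_ (by positivity) (abs_nonneg K)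
      have h0 := abs_nonneg (v (zeroIdx N m) x)
      rw [← sq_abs]
      rcases le_total |v (zeroIdx N m) x| 1 with h | h
      · have := Real.rpow_le_one h0 h (by linarith : 0 ≤ q + 1)
        nlinarith [sq_nonneg |v (zeroIdx N m) x|]
      · have := Real.rpow_le_rpow_of_exponent_le h (by linarith : q + 1 ≤ 2)
        rw [Real.rpow_two] at this
        linarith
  have hint : Integrable (energyDensity A a q v) (volume.restrict Ω) := by
    refine hDint.mono' (aemeasurable_energyDensity hΩo hA ham v).aestronglyMeasurable ?_
    filter_upwards [hle, energyDensity_nonneg (q := q) hΩo hcoer ha0 v] with x h1 h2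
    rwa [Real.norm_of_nonneg h2]
  refine ⟨hint, (integral_mono_ae hint hDint hle).trans ?_⟩
  have hnorm : ∀ γ, ‖v γ‖ ^ 2 ≤ ‖v‖ ^ 2 := fun γ =>
    pow_le_pow_left₀ (norm_nonneg _) (PiLp.norm_apply_le v γ) 2
  have hsum : ∫ x in Ω, ∑ α ∈ topIdx N m, ∑ γ ∈ topIdx N m, (v γ x ^ 2 + v α x ^ 2) ≤
      n * (n * 2) * ‖v‖ ^ 2 := by
    rw [integral_finsetSum _ fun α _ => hi1 α]
    have h1 : ∀ α ∈ topIdx N m, ∫ x in Ω, ∑ γ ∈ topIdx N m, (v γ x ^ 2 + v α x ^ 2) ≤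
        n * (2 * ‖v‖ ^ 2) := by
      intro α _
      refine (integral_finsetSum _ fun γ _ => (hsq γ).add (hsq α)).trans_le ?_
      rw [hn, ← nsmul_eq_mul]
      refine Finset.sum_le_card_nsmul _ _ _ fun γ _ => ?_
      refine (integral_add (hsq γ) (hsq α)).trans_le ?_
      rw [← norm_sq_eq_integral, ← norm_sq_eq_integral]
      linarith [hnorm γ, hnorm α]
    refine (Finset.sum_le_card_nsmul _ _ _ h1).trans_eq ?_
    rw [nsmul_eq_mul]
    ring
  have hzero : ∫ x in Ω, (v (zeroIdx N m) x ^ 2 + 1) ≤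
      ‖v‖ ^ 2 + (volume.restrict Ω).real univ := by
    rw [integral_add (hsq _) (integrable_const 1), ← norm_sq_eq_integral]
    simpa using hnorm (zeroIdx N m)
  rw [hD, integral_add (hi2.const_mul _) (hi3.const_mul _), integral_const_mul,
    integral_const_mul]
  have h1 := mul_le_mul_of_nonneg_left hsum (abs_nonneg c)
  have h2 := mul_le_mul_of_nonneg_left hzero (abs_nonneg K)
  linarith

theorem topEnergy_add_absorption_le (hΩo : IsOpen Ω) (hΩb : Bornology.IsBounded Ω)
    (ham : AEMeasurable a (volume.restrict Ω)) (ha0 : ∀ x ∈ Ω, 0 ≤ a x)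
    (hab : ∃ K : ℝ, ∀ x ∈ Ω, a x ≤ K) (hq0 : 0 < q) (hq1 : q < 1) {C : ℝ}
    (hC : ∀ x ∈ Ω, ∀ ξ : MIdx N m → ℝ,
      C * ∑ γ ∈ topIdx N m, |ξ γ| ^ 2 ≤ ∑ α ∈ topIdx N m, A α x ξ * ξ α) {v : Jets Ω m}
    (hv : Integrable (energyDensity A a q v) (volume.restrict Ω)) :
    C * topEnergy v + ∫ x in Ω, a x * |v (zeroIdx N m) x| ^ (q + 1) ≤
      ∫ x in Ω, energyDensity A a q v x := by
  have hsq : ∀ γ, Integrable (fun x => v γ x ^ 2) (volume.restrict Ω) := fun γ =>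
    (Lp.memLp (v γ)).integrable_sq
  have hi1 : Integrable (fun x => ∑ γ ∈ topIdx N m, v γ x ^ 2) (volume.restrict Ω) :=
    integrable_finsetSum _ fun γ _ => hsq γ
  have hi2 := integrable_absorption hΩo hΩb ham ha0 hab hq0 hq1 (v (zeroIdx N m))
  have h := integral_mono_ae ((hi1.const_mul C).add hi2) hv (energyDensity_ge hΩo hC v)
  refine le_trans (le_of_eq ?_) h
  refine Eq.trans ?_ (integral_add (hi1.const_mul C) hi2).symm
  rw [integral_const_mul, integral_finsetSum _ fun γ _ => hsq γ, topEnergy]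
  simp_rw [norm_sq_eq_integral]

end EnergyDensity

/-! ### Energy identity and extinction criterion for weak solutions. -/

section Extinction

variable {N m : ℕ} {Ω : Set (Sp N)} {A : MIdx N m → Sp N → (MIdx N m → ℝ) → ℝ} {a : Sp N → ℝ}
  {q : ℝ}

theorem rpow_sub_one_mul_self_mul_self (hq0 : 0 < q) (r : ℝ) :
    |r| ^ (q - 1) * r * r = |r| ^ (q + 1) := by
  rcases eq_or_ne r 0 with rfl | hr
  · simp [Real.zero_rpow (by linarith : q + 1 ≠ 0)]
  · have h : 0 < |r| := abs_pos.2 hr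
    rw [mul_assoc, ← sq, ← sq_abs, ← Real.rpow_two, ← Real.rpow_add h]
    congr 1
    ring

/-- The energy identity for weak solutions. -/
theorem IsWeakSolution.norm_sq_sub_eq (hΩo : IsOpen Ω) (hΩb : Bornology.IsBounded Ω)
    (hA : StructureCondition Ω A) (hcoer : StronglyCoercive Ω A)
    (ham : AEMeasurable a (volume.restrict Ω)) (ha0 : ∀ x ∈ Ω, 0 ≤ a x)
    (hab : ∃ K : ℝ, ∀ x ∈ Ω, a x ≤ K) (hq0 : 0 < q) (hq1 : q < 1) {u₀ : L2 Ω} {u : ℝ → L2 Ω}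
    (hu : IsWeakSolution Ω A a q u₀ u) :
    ∃ U : ℝ → W0 Ω m, (∀ᵐ t ∂volume.restrict (Ioi (0 : ℝ)), toL2 (U t) = u t) ∧
      (∀ s t, 0 < s → s ≤ t →
        IntegrableOn (fun r => ∫ x in Ω, energyDensity A a q (U r).1 x) (Ioc s t)) ∧
      ∀ s t, 0 < s → s ≤ t → ‖u s‖ ^ 2 - ‖u t‖ ^ 2 =
        2 * ∫ r in Ioc s t, ∫ x in Ω, energyDensity A a q (U r).1 x := by
  obtain ⟨huc, -, U, w, hU, hUu, hw, hd, heq⟩ := hu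
  obtain ⟨C₁, C₂, hC⟩ := exists_integral_energyDensity_le (q := q) hΩo hΩb hA hcoer ham ha0 hab
    hq0 hq1
  set e : ℝ → ℝ := fun r => ∫ x in Ω, energyDensity A a q (U r).1 x with he
  have he0 : ∀ r, 0 ≤ e r := fun r =>
    integral_nonneg_of_ae (energyDensity_nonneg hΩo hcoer ha0 (U r).1)
  have hUsq : ∀ T, 0 < T → IntegrableOn (fun r => ‖U r‖ ^ 2) (Ioo 0 T) := fun T hT =>
    (hU T hT).integrable_norm_pow (by norm_num)
  have heint : ∀ T, 0 < T → IntegrableOn e (Ioo 0 T) := by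
    intro T hT
    have hmeas : AEStronglyMeasurable e (volume.restrict (Ioo 0 T)) := by
      have h1 : AEStronglyMeasurable (fun r => (U r).1) (volume.restrict (Ioo 0 T)) :=
        continuous_subtype_val.comp_aestronglyMeasurable (hU T hT).aestronglyMeasurable
      have h2 := (aemeasurable_comp_of_lowerSemicontinuous
        (lowerSemicontinuous_lintegral_energyDensity (q := q) hΩo hA ham hq0) h1).ennreal_toReal
      refine (h2.congr (Eventually.of_forall fun r => ?_)).aestronglyMeasurable
      exact (integral_eq_lintegral_of_nonneg_ae (energyDensity_nonneg hΩo hcoer ha0 (U r).1)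
        (hC (U r).1).1.aestronglyMeasurable).symm
    refine (((hUsq T hT).const_mul C₁).add (integrable_const C₂)).mono' hmeas
      (Eventually.of_forall fun r => ?_)
    rw [Real.norm_of_nonneg (he0 r)]
    exact (hC (U r).1).2
  -- Integrability of the two terms separately is needed: the equation only says that the integral
  -- of their sum is zero.
  have hwU : ∀ T, 0 < T → IntegrableOn (fun r => w r (U r)) (Ioo 0 T) := by
    intro T hT
    have hmeas : AEStronglyMeasurable (fun r => w r (U r)) (volume.restrict (Ioo 0 T)) :=
      (isBoundedBilinearMap_apply (𝕜 := ℝ) (E := W0 Ω m)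
        (F := ℝ)).continuous.comp_aestronglyMeasurable
        ((hw T hT).aestronglyMeasurable.prodMk (hU T hT).aestronglyMeasurable)
    refine (((hw T hT).integrable_norm_pow (by norm_num)).add (hUsq T hT)).mono' hmeas
      (Eventually.of_forall fun r => ?_)
    refine ((w r).le_opNorm _).trans ?_
    simp only [Pi.add_apply]
    nlinarith [sq_nonneg (‖w r‖ - ‖U r‖), norm_nonneg (w r), norm_nonneg (U r)]
  have hbal : ∀ T, 0 < T → ∫ r in Ioo 0 T, w r (U r) = -∫ r in Ioo 0 T, e r := by
    intro T hT
    -- The solution itself is an admissible test function; the absorption term becomes a|u|^{q+1}.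
    have h1 := heq U hU T hT
    have h2 : ∫ r in Ioo 0 T, (w r (U r) + e r) = 0 := by
      refine Eq.trans ?_ h1
      refine integral_congr_ae ?_
      filter_upwards [ae_restrict_of_ae_restrict_of_subset Ioo_subset_Ioi_self hUu] with r hr
      refine congrArg (fun z : ℝ => w r (U r) + z) (integral_congr_ae (Eventually.of_forall fun x => ?_))
      have h3 : toL2 (U r) = (U r).1 (zeroIdx N m) := rfl
      simp only [energyDensity, ← hr, weakD, h3]
      rw [mul_assoc (a x), rpow_sub_one_mul_self_mul_self hq0]
    rw [integral_add (hwU T hT) (heint T hT)] at h2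
    linarith
  have hsplit : ∀ {f : ℝ → ℝ}, (∀ T, 0 < T → IntegrableOn f (Ioo 0 T)) → ∀ s t, 0 < s → s ≤ t →
      IntegrableOn f (Ioc s t) ∧
      ∫ r in Ioc s t, f r = (∫ r in Ioo 0 t, f r) - ∫ r in Ioo 0 s, f r := by
    intro f hf s t hs hst
    have h1 : IntegrableOn f (Ioc 0 t) := (hf (t + 1) (by linarith)).mono_set fun x hx =>
      ⟨hx.1, by linarith [hx.2]⟩
    have h2 := h1.mono_set (Ioc_subset_Ioc_right hst : Ioc 0 s ⊆ Ioc 0 t)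
    have h3 := h1.mono_set (Ioc_subset_Ioc_left hs.le : Ioc s t ⊆ Ioc 0 t)
    refine ⟨h3, ?_⟩
    rw [← integral_Ioc_eq_integral_Ioo, ← integral_Ioc_eq_integral_Ioo,
      ← Ioc_union_Ioc_eq_Ioc hs.le hst, setIntegral_union (Ioc_disjoint_Ioc_of_le le_rfl)
        measurableSet_Ioc h2 h3]
    ring
  refine ⟨U, hUu, fun s t hs hst => (hsplit heint s t hs hst).1, fun s t hs hst => ?_⟩
  have hdual : ∀ (v : W0 Ω m) (s T : ℝ), 0 < s → s ≤ T →
      inner ℝ (u T) (toL2 v) - inner ℝ (u s) (toL2 v) = ∫ r in Ioc s T, w r v := by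
    intro v s T hs hsT
    refine sub_eq_setIntegral_of_weakDeriv (f := fun t => inner ℝ (u t) (toL2 v))
      (g := fun t => w t v) (huc.inner continuousOn_const) (fun T hT => ?_)
      (fun η h1 h2 h3 => hd v η h1 h2 h3) hs hsT
    exact ((hw T hT).integrable (by norm_num)).apply_continuousLinearMap v
  have h1 := norm_sq_sub_eq_integral huc hU hw hUu hdual hs hst
  have ht := hs.trans_le hst
  rw [(hsplit hwU s t hs hst).2, hbal t ht, hbal s hs] at h1
  rw [(hsplit heint s t hs hst).2]
  linarith

/-- Extinction holds as soon as the sets `{a ≤ s}` carry a part of the `L²` norm that is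
summable along a suitable geometric sequence of values of `s`. -/
theorem extinctionInFiniteTime_of_summable (hN : 1 ≤ N) (hm : 1 ≤ m) (hΩo : IsOpen Ω)
    (hΩb : Bornology.IsBounded Ω)
    (hA : StructureCondition Ω A) (hcoer : StronglyCoercive Ω A)
    (hq0 : 0 < q) (hq1 : q < 1)
    (ham : AEMeasurable a (volume.restrict Ω)) (ha0 : ∀ x ∈ Ω, 0 ≤ a x)
    (hab : ∃ K : ℝ, ∀ x ∈ Ω, a x ≤ K) {Φ : ℕ → ℝ} (hΦ : Summable Φ) {k₀ : ℕ}
    (h : ∀ k, k₀ ≤ k → ∀ v : W0 Ω m,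
      ∫ x in {x | a x ≤ ((1 / 2 : ℝ) ^ ((1 - q) / 4)) ^ k}, toL2 v x ^ 2 ∂volume.restrict Ω ≤
        Φ k * topEnergy v.1) :
    ExtinctionInFiniteTime Ω A a q := by
  have hfin : IsFiniteMeasure (volume.restrict Ω) := ⟨by simpa using hΩb.measure_lt_top⟩
  intro u₀ u hu
  obtain ⟨K, σ, hK0, hσ, hK⟩ := exists_setIntegral_le_rpow hN hm hΩo hΩb
  obtain ⟨U, hUu, hint, hbal⟩ := hu.norm_sq_sub_eq hΩo hΩb hA hcoer ham ha0 hab hq0 hq1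
  obtain ⟨C₁, C₂, hI⟩ := exists_integral_energyDensity_le (q := q) hΩo hΩb hA hcoer ham ha0 hab
    hq0 hq1
  obtain ⟨C, hC0, hC⟩ := id hcoer
  set ρ : ℝ := (1 / 2 : ℝ) ^ ((1 - q) / 4) with hρ
  have hρ0 : 0 < ρ := by positivity
  have hρ1 : ρ < 1 := Real.rpow_lt_one (by norm_num) (by norm_num) (by linarith)
  have hE : ∀ v : W0 Ω m, topEnergy v.1 ≤ C⁻¹ * ∫ x in Ω, energyDensity A a q v.1 x ∧
      ∫ x in Ω, a x * |toL2 v x| ^ (q + 1) ≤ ∫ x in Ω, energyDensity A a q v.1 x := by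
    intro v
    have h1 := topEnergy_add_absorption_le hΩo hΩb ham ha0 hab hq0 hq1 hC (hI v.1).1
    have h2 : 0 ≤ ∫ x in Ω, a x * |toL2 v x| ^ (q + 1) := by
      refine integral_nonneg_of_ae ?_
      filter_upwards [ae_restrict_mem hΩo.measurableSet] with x hx
      have := ha0 x hx
      simp only [Pi.zero_apply]
      positivity
    have h3 : 0 ≤ C * topEnergy v.1 := mul_nonneg hC0.le (topEnergy_nonneg _)
    have h4 : ∫ x in Ω, a x * |toL2 v x| ^ (q + 1) =
      ∫ x in Ω, a x * |v.1 (zeroIdx N m) x| ^ (q + 1) := rfl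
    refine ⟨?_, by linarith⟩
    rw [inv_mul_eq_div, le_div_iff₀ hC0]
    linarith
  have hpow : ∀ k : ℕ, ((1 / 2 : ℝ) ^ k) ^ ((1 - q) / 4) = ρ ^ k := by
    intro k
    rw [hρ, ← Real.rpow_natCast, ← Real.rpow_natCast, ← Real.rpow_mul (by norm_num),
      ← Real.rpow_mul (by norm_num), mul_comm]
  -- The three terms come from {a ≤ ρ^k}, from the exceptional set where u is large, and from the
  -- rest; the last two are geometric.
  set g : ℕ → ℝ := fun k => C⁻¹ * |Φ k| + K * C⁻¹ * (ρ ^ k) ^ σ + ρ ^ k with hg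
  have hgs : Summable g := by
    refine ((hΦ.abs.mul_left _).add (Summable.mul_left _ ?_)).add
      (summable_geometric_of_lt_one hρ0.le hρ1)
    have h1 : ∀ k : ℕ, (ρ ^ k) ^ σ = (ρ ^ σ) ^ k := fun k => by
      rw [← Real.rpow_natCast, ← Real.rpow_natCast, ← Real.rpow_mul hρ0.le,
        ← Real.rpow_mul hρ0.le, mul_comm]
    simp_rw [h1]
    exact summable_geometric_of_lt_one (by positivity) (Real.rpow_lt_one hρ0.le hρ1 hσ)
  -- Taking A to be the whole space turns the localized inequality into Poincaré's; it brings y down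
  -- to the first usable level.
  have hpoinc : ∀ᵐ t ∂volume.restrict (Ioi (0 : ℝ)), ‖u t‖ ^ 2 ≤
      K * (volume.restrict Ω).real univ ^ σ * C⁻¹ *
        ∫ x in Ω, energyDensity A a q (U t).1 x := by
    filter_upwards [hUu] with t ht
    have h1 := hK (U t) univ MeasurableSet.univ.nullMeasurableSet
    rw [Measure.restrict_univ, ← norm_sq_eq_integral, ht] at h1
    refine h1.trans ?_
    rw [mul_assoc _ C⁻¹]
    exact mul_le_mul_of_nonneg_left (hE (U t)).1 (by positivity)
  have hscale : ∀ k, k₀ ≤ k → ∀ᵐ t ∂volume.restrict (Ioi (0 : ℝ)),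
      ∫ x in Ω, energyDensity A a q (U t).1 x ≤ (1 / 2) ^ k →
      ‖u t‖ ^ 2 ≤ (∫ x in Ω, energyDensity A a q (U t).1 x) * g k := by
    intro k hk
    filter_upwards [hUu] with t ht hle
    have h1 := norm_sq_le_mul_energy hΩo hΩb ham ha0 hab hq0 hq1 hK0 hσ (inv_pos.2 hC0).le hK
      (U t) (hE (U t)).1 (hE (U t)).2 (ε := (1 / 2) ^ k) (Φ := |Φ k|) (by positivity) hle
      (by
        rw [hpow]
        exact (h k hk (U t)).trans
          (mul_le_mul_of_nonneg_right (le_abs_self _) (topEnergy_nonneg _))) (abs_nonneg _)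
    rw [hpow, ht] at h1
    exact h1
  obtain ⟨T, hT, hzero⟩ := exists_eq_zero_of_dissipation (y := fun t => ‖u t‖ ^ 2)
    (e := fun t => ∫ x in Ω, energyDensity A a q (U t).1 x) (fun t _ => sq_nonneg _)
    (Eventually.of_forall fun t =>
      integral_nonneg_of_ae (energyDensity_nonneg hΩo hcoer ha0 (U t).1))
    hint hbal hpoinc (fun k => by simp only [hg]; positivity) hgs hscale
  refine ⟨T, hT, fun t ht => ?_⟩
  have h1 : u t = 0 := by simpa using hzero t ht
  rw [h1]
  exact Lp.coeFn_zero _ _ _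

theorem measureReal_sublevel (ham : AEMeasurable a (volume.restrict Ω)) (s : ℝ) :
    (volume.restrict Ω).real {x | a x ≤ s} = sublevelMeas Ω a s := by
  rw [Measure.real, Measure.restrict_apply₀ (nullMeasurableSet_le ham aemeasurable_const),
    sublevelMeas, Measure.real]
  congr 2
  ext x
  exact and_comm

theorem sublevelMeas_mono (hΩb : Bornology.IsBounded Ω) {s t : ℝ} (hst : s ≤ t) :
    sublevelMeas Ω a s ≤ sublevelMeas Ω a t :=
  measureReal_mono (fun _ hx => ⟨hx.1, hx.2.trans hst⟩)
    ((measure_mono fun _ hx => hx.1).trans_lt hΩb.measure_lt_top).ne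

/-- Continuity of the measure from above. In the critical case this secures small sublevel sets,
which integrability alone does not: if M_a = 1 near 0, the integrand vanishes there. -/
theorem exists_sublevelMeas_le (hΩb : Bornology.IsBounded Ω)
    (ham : AEMeasurable a (volume.restrict Ω)) (ha0 : ∀ x ∈ Ω, 0 ≤ a x)
    (hz : volume {x ∈ Ω | a x = 0} = 0) {ε : ℝ} (hε : 0 < ε) :
    ∃ s, 0 < s ∧ sublevelMeas Ω a s ≤ ε := by
  have hfin : IsFiniteMeasure (volume.restrict Ω) := ⟨by simpa using hΩb.measure_lt_top⟩
  have hanti : Antitone fun n : ℕ => {x : Sp N | a x ≤ 1 / ((n : ℝ) + 1)} := by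
    intro i j hij x hx
    have hij' : (i : ℝ) ≤ j := by exact_mod_cast hij
    have h1 : a x ≤ 1 / ((j : ℝ) + 1) := hx
    exact h1.trans (one_div_le_one_div_of_le (by positivity) (by linarith))
  have hlim := tendsto_measure_iInter_atTop (μ := volume.restrict Ω)
    (fun n : ℕ => nullMeasurableSet_le ham (aemeasurable_const (b := 1 / ((n : ℝ) + 1))))
    hanti ⟨0, measure_ne_top _ _⟩
  have hnull : NullMeasurableSet (⋂ n : ℕ, {x : Sp N | a x ≤ 1 / ((n : ℝ) + 1)})
      (volume.restrict Ω) := NullMeasurableSet.iInter fun n =>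
    nullMeasurableSet_le ham aemeasurable_const
  have h0 : volume.restrict Ω (⋂ n : ℕ, {x : Sp N | a x ≤ 1 / ((n : ℝ) + 1)}) = 0 := by
    rw [Measure.restrict_apply₀ hnull]
    refine measure_mono_null (t := {x ∈ Ω | a x = 0}) (fun x hx => ⟨hx.2, ?_⟩) hz
    refine le_antisymm ?_ (ha0 x hx.2)
    exact ge_of_tendsto' tendsto_one_div_add_atTop_nhds_zero_nat fun n => mem_iInter.1 hx.1 n
  rw [h0] at hlim
  obtain ⟨n, hn⟩ := ((ENNReal.tendsto_toReal ENNReal.zero_ne_top).comp hlim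
    |>.eventually_le_const (by simpa using hε)).exists
  exact ⟨1 / ((n : ℝ) + 1), by positivity, by rw [← measureReal_sublevel ham]; exact hn⟩

/-- The derivative -log x - 1 is nonnegative exactly up to e^{-1}, so sublevel measures must be
brought below this value before the profile is monotone. -/
theorem mul_neg_log_mono {r t : ℝ} (hr : 0 ≤ r) (hrt : r ≤ t) (ht : t ≤ Real.exp (-1)) :
    r * -Real.log r ≤ t * -Real.log t := by
  have hmono : MonotoneOn Real.negMulLog (Icc 0 (Real.exp (-1))) := by
    refine monotoneOn_of_deriv_nonneg (convex_Icc _ _)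
      Real.continuous_negMulLog.continuousOn ?_ ?_
    · intro x hx
      rw [interior_Icc] at hx
      exact (Real.differentiableAt_negMulLog_iff.2 hx.1.ne').differentiableWithinAt
    · intro x hx
      rw [interior_Icc] at hx
      rw [Real.deriv_negMulLog hx.1.ne']
      have := Real.log_le_log hx.1 hx.2.le
      rw [Real.log_exp] at this
      linarith
  have := hmono ⟨hr, hrt.trans ht⟩ ⟨hr.trans hrt, ht⟩ hrt
  simpa [Real.negMulLog] using this

end Extinction

end Extinction

end

/-! ### The two cases of the theorem. -/

theorem theorem1p1 (N m : ℕ) (hN : 1 ≤ N) (hm : 1 ≤ m)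
    (Ω : Set (Extinction.Sp N)) (hΩo : IsOpen Ω) (hΩc : IsConnected Ω)
    (hΩb : Bornology.IsBounded Ω)
    (A : Extinction.MIdx N m → Extinction.Sp N → (Extinction.MIdx N m → ℝ) → ℝ)
    (hA : Extinction.StructureCondition Ω A) (hcoer : Extinction.StronglyCoercive Ω A)
    (q : ℝ) (hq0 : 0 < q) (hq1 : q < 1)
    (a : Extinction.Sp N → ℝ) (ham : AEMeasurable a (volume.restrict Ω))
    (ha0 : ∀ x ∈ Ω, 0 ≤ a x) (hab : ∃ K : ℝ, ∀ x ∈ Ω, a x ≤ K) :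
    (N ≠ 2 * m →
      IntegrableOn (fun s : ℝ =>
        s⁻¹ * Extinction.sublevelMeas Ω a s ^ min (2 * (m : ℝ) / (N : ℝ)) 1) (Ioo 0 1) →
      Extinction.ExtinctionInFiniteTime Ω A a q) ∧
    (N = 2 * m →
      volume {x ∈ Ω | a x = 0} = 0 →
      IntegrableOn (fun s : ℝ =>
        s⁻¹ * Extinction.sublevelMeas Ω a s * (-Real.log (Extinction.sublevelMeas Ω a s)))
        (Ioo 0 1) →
      Extinction.ExtinctionInFiniteTime Ω A a q) := by
  have hρ0 : (0 : ℝ) < (1 / 2 : ℝ) ^ ((1 - q) / 4) := by positivity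
  have hρ1 : (1 / 2 : ℝ) ^ ((1 - q) / 4) < 1 :=
    Real.rpow_lt_one (by norm_num) (by norm_num) (by linarith)
  have hM0 : ∀ s, 0 ≤ Extinction.sublevelMeas Ω a s := fun s => measureReal_nonneg
  have hnull : ∀ s : ℝ, NullMeasurableSet {x | a x ≤ s} (volume.restrict Ω) := fun s =>
    nullMeasurableSet_le ham aemeasurable_const
  refine ⟨fun hne hint => ?_, fun heq hz hint => ?_⟩
  · have hN0 : (0 : ℝ) < N := by exact_mod_cast hN
    have hm0 : (0 : ℝ) < m := by exact_mod_cast hm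
    have hθ : 0 < min (2 * (m : ℝ) / (N : ℝ)) 1 := lt_min (by positivity) one_pos
    obtain ⟨K, hK0, hK⟩ := Extinction.exists_setIntegral_le_rpow_of_ne hN hm hΩo hΩb hne
    have hsum := Extinction.summable_of_integrableOn_inv_mul hρ0 hρ1 one_pos
      (H := fun s => Extinction.sublevelMeas Ω a s ^ min (2 * (m : ℝ) / (N : ℝ)) 1)
      (fun s _ _ => Real.rpow_nonneg (hM0 s) _)
      (fun s t _ hst _ => Real.rpow_le_rpow (hM0 s) (Extinction.sublevelMeas_mono hΩb hst) hθ.le)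
      hint
    refine Extinction.extinctionInFiniteTime_of_summable hN hm hΩo hΩb hA hcoer hq0 hq1 ham ha0
      hab (hsum.mul_left K) (k₀ := 0) fun k _ v => ?_
    have h := hK v _ (hnull (((1 / 2 : ℝ) ^ ((1 - q) / 4)) ^ k))
    rwa [Extinction.measureReal_sublevel ham] at h
  · obtain ⟨K, hK0, hK⟩ := Extinction.exists_setIntegral_le_log_of_eq hN hm hΩo hΩb heq
    obtain ⟨s₁, hs₁, hMs₁⟩ := Extinction.exists_sublevelMeas_le hΩb ham ha0 hz
      (Real.exp_pos (-1))
    have hMle : ∀ s, s ≤ s₁ → Extinction.sublevelMeas Ω a s ≤ Real.exp (-1) := fun s hs =>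
      (Extinction.sublevelMeas_mono hΩb hs).trans hMs₁
    have he1 : Real.exp (-1) < 1 := by simp
    have hsum := Extinction.summable_of_integrableOn_inv_mul hρ0 hρ1 hs₁
      (H := fun s => Extinction.sublevelMeas Ω a s *
        -Real.log (Extinction.sublevelMeas Ω a s))
      (fun s _ hs => mul_nonneg (hM0 s)
        (neg_nonneg.2 (Real.log_nonpos (hM0 s) ((hMle s hs).trans he1.le))))
      (fun s t _ hst ht => Extinction.mul_neg_log_mono (hM0 s)
        (Extinction.sublevelMeas_mono hΩb hst) (hMle t ht))
      (by simpa only [mul_assoc] using hint)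
    obtain ⟨k₀, hk₀⟩ := exists_pow_lt_of_lt_one hs₁ hρ1
    refine Extinction.extinctionInFiniteTime_of_summable hN hm hΩo hΩb hA hcoer hq0 hq1 ham ha0
      hab (hsum.mul_left (3 * K)) (k₀ := k₀) fun k hk v => ?_
    set s := ((1 / 2 : ℝ) ^ ((1 - q) / 4)) ^ k with hs
    have hss : s ≤ s₁ := (pow_le_pow_of_le_one hρ0.le hρ1.le hk).trans hk₀.le
    have h := hK v _ (hnull s)
    rw [Extinction.measureReal_sublevel ham] at h
    refine (h ((hMle s hss).trans_lt he1)).trans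
      (mul_le_mul_of_nonneg_right ?_ (Extinction.topEnergy_nonneg _))
    -- As M ≤ e^{-1} gives -log M ≥ 1 when M > 0, the constant 2 is absorbed into 2(-log M), leaving
    -- the profile of the hypothesis.
    have h1 : Extinction.sublevelMeas Ω a s * (2 - Real.log (Extinction.sublevelMeas Ω a s)) ≤
        3 * (Extinction.sublevelMeas Ω a s * -Real.log (Extinction.sublevelMeas Ω a s)) := by
      rcases (hM0 s).eq_or_lt with h0 | h0
      · simp [← h0]
      · have h2 := Real.log_le_log h0 (hMle s hss)
        rw [Real.log_exp] at h2
        nlinarith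
    nlinarith
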